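/- Let $\eta=(\eta_n)_{n\in\mathbb Z}\in\{0,1\}^{\mathbb Z}$ be a particle configuration. Its path encoding $S=(S_n)_{n\in\mathbb Z}$ is given by $S_0=0$ and $S_n=S_{n-1}+1-2\eta_n$ for all $n\in\mathbb Z$. With $M_n=\sup_{m\le n}S_m$, the box-ball system (BBS) map is defined at $\eta$ when $M_0<\infty$; in that case $T\eta$ is the configuration with path encoding $(TS)_n=2M_n-S_n-2M_0$, that is, $(T\eta)_n=\mathbf 1_{\{(TS)_n=(TS)_{n-1}-1\}}$. Suppose that $\eta$ is a random configuration, on a probability space with probability measure $\mathbf P$, given by one of the following three examples. (a) $(\eta_n)_{n\in\mathbb Z}$ are i.i.d. Bernoulli($p$) random variables for some $p\in[0,\frac12)$. (b) $(\eta_n)_{n\in\mathbb Z}$ is a two-sided stationary Markov chain on $\{0,1\}$ with transition matrix $\begin{pmatrix}1-p_0&p_0\\1-p_1&p_1\end{pmatrix}$, where $p_0\in(0,1)$, $p_1\in[0,1)$ and $p_0+p_1<1$. (c) For some $p\in(0,1)$ and $K\in\{0,1,2,\dots\}$, $\eta$ is the i.i.d. Bernoulli($p$) configuration conditioned so that its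 carrier $W=M-S$ satisfies $\sup_{n\in\mathbb Z}W_n\le K$, this conditioning on a null event being understood as follows. Let $P^{(K)}$ be the matrix on $\{0,\dots,K\}$ with $P^{(K)}(x,x+1)=p$ for $0\le x<K$, $P^{(K)}(x,x-1)=1-p$ for $1\le x\le K$, $P^{(K)}(0,0)=1-p$, and all other entries $0$. Let $\lambda_K$ be its Perron-Frobenius eigenvalue, let $h_K$ be a corresponding strictly positive right eigenvector, and let $\tilde W$ be the two-sided stationary Markov chain on $\{0,\dots,K\}$ with transition matrix $\tilde P^{(K)}(x,y)=\dfrac{P^{(K)}(x,y)h_K(y)}{\lambda_K h_K(x)}$. Then $\eta_n=\mathbf 1_{\{\tilde W_n=\tilde W_{n-1}+1\}}$ for all $n\in\mathbb Z$. Then, $\mathbf P$-almost surely, $T\eta$ is well defined, and the transformation $\eta\mapsto T\eta$ is ergodic: it preserves the law of $\eta$, and every measurable set $A\subseteq\{0,1\}^{\mathbb Z}$ with $T^{-1}A=A$ has probability $0$ or $1$ under that law. -/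

import Mathlib

open MeasureTheory ProbabilityTheory

/-- Particle configurations on the integers: `η n = 1` means there is a particle at `n`. -/
abbrev Config : Type := ℤ → Fin 2

/-- The path encoding `S` of `η`: the two-sided path with `S 0 = 0` and
`S n = S (n - 1) + 1 - 2 η n`, see `pathEncoding_zero` and `pathEncoding_step`.
(One of the two sums below is always empty.) -/
noncomputable def pathEncoding (η : Config) (n : ℤ) : ℤ :=
  ∑ i ∈ Finset.Ioc 0 n, (1 - 2 * ((η i : ℕ) : ℤ)) -
    ∑ i ∈ Finset.Ioc n 0, (1 - 2 * ((η i : ℕ) : ℤ))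

theorem pathEncoding_zero (η : Config) : pathEncoding η 0 = 0 := by
  simp [pathEncoding]

theorem pathEncoding_step (η : Config) (n : ℤ) :
    pathEncoding η n = pathEncoding η (n - 1) + 1 - 2 * ((η n : ℕ) : ℤ) := by
  rcases le_or_gt n 0 with hn | hn
  · have h1 : Finset.Ioc 0 n = ∅ := Finset.Ioc_eq_empty (by omega)
    have h2 : Finset.Ioc 0 (n - 1) = ∅ := Finset.Ioc_eq_empty (by omega)
    have h3 : Finset.Ioc (n - 1) 0 = insert n (Finset.Ioc n 0) := by
      ext i; simp only [Finset.mem_Ioc, Finset.mem_insert]; omega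
    simp only [pathEncoding, h1, h2, h3]
    rw [Finset.sum_insert (by simp)]
    simp only [Finset.sum_empty]
    ring
  · have h1 : Finset.Ioc n 0 = ∅ := Finset.Ioc_eq_empty (by omega)
    have h2 : Finset.Ioc (n - 1) 0 = ∅ := Finset.Ioc_eq_empty (by omega)
    have h3 : Finset.Ioc 0 n = insert n (Finset.Ioc 0 (n - 1)) := by
      ext i; simp only [Finset.mem_Ioc, Finset.mem_insert]; omega
    simp only [pathEncoding, h1, h2, h3]
    rw [Finset.sum_insert (by simp)]
    simp only [Finset.sum_empty]
    ring

/-- The past maximum `M n = sup_{m ≤ n} S m` of a path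
(meaningful when `S` is bounded above on the negative half-line). -/
noncomputable def pastMax (S : ℤ → ℤ) (n : ℤ) : ℤ := sSup (S '' Set.Iic n)

/-- Reflection in the past maximum: `(T S) n = 2 M n - S n - 2 M 0`. -/
noncomputable def pitman (S : ℤ → ℤ) (n : ℤ) : ℤ :=
  2 * pastMax S n - S n - 2 * pastMax S 0

/-- One time step of the box-ball system is well defined at `η`: `M 0 < ∞`. -/
def BBSDefined (η : Config) : Prop := BddAbove (pathEncoding η '' Set.Iic 0)

/-- One time step `T` of the two-sided box-ball system: `T η` is the configuration whose path
encoding is `T S`, that is, it has a particle at `n` exactly when `T S` steps down at `n`.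
Only its values on `{η | BBSDefined η}` matter. -/
noncomputable def bbs (η : Config) : Config := fun n =>
  if pitman (pathEncoding η) n = pitman (pathEncoding η) (n - 1) - 1 then 1 else 0

/-- `X` is a two-sided stationary Markov chain, under the probability measure `P`, on the finite
state space `E`, with transition matrix `Q`. The last field is the Markov property
`P(X_{n+k+1} = x_{k+1} | X_n = x_0, …, X_{n+k} = x_k) = Q (x_k) (x_{k+1})`
with the conditioning event multiplied out. -/
structure IsStationaryMarkovChain {Ω E : Type*} [MeasurableSpace Ω] [MeasurableSpace E]
    (P : Measure Ω) (X : Ω → ℤ → E) (Q : Matrix E E ℝ) : Prop where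
  measurable : Measurable X
  stationary : P.map (fun ω n => X ω (n + 1)) = P.map X
  markov : ∀ (n : ℤ) (k : ℕ) (x : ℕ → E),
    P.real {ω | ∀ i ≤ k + 1, X ω (n + (i : ℤ)) = x i} =
      P.real {ω | ∀ i ≤ k, X ω (n + (i : ℤ)) = x i} * Q (x k) (x (k + 1))

/-- First example: i.i.d. Bernoulli variables with parameter `p ∈ [0, 1/2)`. -/
def IsIIDExample {Ω : Type*} [MeasurableSpace Ω] (P : Measure Ω) (η : Ω → Config) : Prop :=
  ∃ p : ℝ, 0 ≤ p ∧ p < 1 / 2 ∧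
    iIndepFun (fun (n : ℤ) (ω : Ω) => η ω n) P ∧
    ∀ n : ℤ, P.real {ω | η ω n = 1} = p

/-- Second example: a two-sided stationary Markov chain on `{0, 1}`. -/
def IsMarkovExample {Ω : Type*} [MeasurableSpace Ω] (P : Measure Ω) (η : Ω → Config) : Prop :=
  ∃ p₀ p₁ : ℝ, 0 < p₀ ∧ p₀ < 1 ∧ 0 ≤ p₁ ∧ p₁ < 1 ∧ p₀ + p₁ < 1 ∧
    IsStationaryMarkovChain P η !![1 - p₀, p₀; 1 - p₁, p₁]

/-- The restriction to `{0, …, K}` of the transition matrix of the simple random walk on the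
nonnegative integers that steps up with probability `p` and otherwise steps down, or stays put
when it is at `0`. -/
noncomputable def restrictedWalk (p : ℝ) (K : ℕ) : Matrix (Fin (K + 1)) (Fin (K + 1)) ℝ :=
  fun x y =>
    if (y : ℕ) = (x : ℕ) + 1 then p
    else if (x : ℕ) = (y : ℕ) + 1 ∨ ((x : ℕ) = 0 ∧ (y : ℕ) = 0) then 1 - p
    else 0

/-- `h` is a strictly positive (right) eigenvector of `A`, with eigenvalue `lam`. When `A` is
nonnegative and irreducible such a pair exists, `lam` is necessarily the eigenvalue of largest
magnitude, and `h` is unique up to scaling (Perron-Frobenius). -/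
def IsPerronPair {E : Type*} [Fintype E] (A : Matrix E E ℝ) (lam : ℝ) (h : E → ℝ) : Prop :=
  (∀ x, 0 < h x) ∧ A.mulVec h = lam • h

/-- The stochastic matrix `A x y * h y / (lam * h x)`. -/
noncomputable def doobTransform {E : Type*} (A : Matrix E E ℝ) (lam : ℝ) (h : E → ℝ) :
    Matrix E E ℝ :=
  fun x y => A x y * h y / (lam * h x)

/-- Third example: i.i.d. Bernoulli variables with parameter `p ∈ (0, 1)` conditioned on the
carrier never exceeding `K`. The conditioned carrier `W` is the two-sided stationary Markov chain
on `{0, …, K}` whose transition matrix is the Doob transform of the restricted walk by its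
Perron eigenvector, and `η` has a particle at `n` exactly when `W` steps up at `n`. -/
def IsBoundedSolitonExample {Ω : Type*} [MeasurableSpace Ω] (P : Measure Ω) (η : Ω → Config) :
    Prop :=
  ∃ (K : ℕ) (p : ℝ) (lam : ℝ) (h : Fin (K + 1) → ℝ) (W : Ω → ℤ → Fin (K + 1)),
    0 < p ∧ p < 1 ∧
    IsPerronPair (restrictedWalk p K) lam h ∧
    IsStationaryMarkovChain P W (doobTransform (restrictedWalk p K) lam h) ∧
    ∀ᵐ ω ∂P, ∀ n : ℤ, η ω n = if (W ω n : ℕ) = (W ω (n - 1) : ℕ) + 1 then 1 else 0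

/-! The carrier `W = M - S` sweeps the configuration from left to right: it picks up every ball it
meets and, while nonempty, drops a ball at every empty site. Thus the particles of `η` are the
up-steps of `W`, and those of `T η` are its down-steps.

Invariance. Reading `W` backwards exchanges up-steps and down-steps, so the reversed carrier yields
the reversal of `T η` exactly as the carrier yields `η`. If the laws of `η` and of `W` are both
invariant under reversal, `T` preserves the law of `η` (`measurePreserving_bbs`). When `η` is a
two-state Markov chain (i.i.d. included), the pairs `(W (n-1), W n)` form a Markov chain satisfying
detailed balance up to swapping the pair (`map_carrier_reverse`). In the bounded example `W` is a
nearest-neighbour chain, hence reversible, and the reversibility of `η` comes from a duality between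
the restricted walk and its transpose (`walkPart_mul_dualityMatrix`).

Ergodicity. Let `D` be the event that the carrier at `n` is nonempty at all times (`neverEmpty`). It
is invariant up to null sets and depends only on sites up to `n`. On an invariant event the particle
density is the same at all sites, because the pattern 10 is carried to the pattern 01
(`measureReal_inter_particle_succ`). Far to the right mixing makes it `ρ * μ D`, while at site `n +
1` the dynamics flips the occupation on `D`, which makes it `μ D / 2`. Since `ρ < 1/2`, `D` is null
(`measureReal_neverEmpty`).

Hence the carrier at every site is empty at arbitrarily late times, and each such moment cuts off
the influence of what lies to the right: in a fixed window, the configuration at late times is a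
function of the initial configuration to the left of any prescribed `L`
(`exists_forall_iterate_bbs_truncate`). An invariant event is therefore approximated by events of
the arbitrarily remote past, and these are trivial by the mixing of the underlying finite chain
(`IsStationaryMarkovChain.measureReal_eq_zero_or_one`). -/

open Filter Topology

/-! ### Finite windows determine a law -/

section Windows

variable {E : Type*} [MeasurableSpace E] [MeasurableSingletonClass E]

theorem measurableSet_coord (n : ℤ) (x : E) : MeasurableSet {f : ℤ → E | f n = x} := by
  have h := (measurable_pi_apply n : Measurable fun f : ℤ → E => f n) (measurableSet_singleton x)
  exact h

theorem measurableSet_window (n : ℤ) (k : ℕ) (x : ℕ → E) :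
    MeasurableSet {f : ℤ → E | ∀ i ≤ k, f (n + (i : ℤ)) = x i} := by
  have : {f : ℤ → E | ∀ i ≤ k, f (n + (i : ℤ)) = x i} =
      ⋂ i : ℕ, ⋂ _ : i ≤ k, {f | f (n + (i : ℤ)) = x i} := by
    ext f; simp
  rw [this]
  exact MeasurableSet.iInter fun i => MeasurableSet.iInter fun _ => measurableSet_coord _ _

end Windows

section Windows

variable {ι E : Type*} [Countable E] [MeasurableSpace E] [MeasurableSingletonClass E]

/-- A finite measure on `ι → E` is determined by the probabilities of an exhausting sequence of
finite windows. -/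
theorem ext_of_windows [Nonempty E] (I : ℕ → Finset ι) (hI : Monotone I)
    (hcov : ∀ i, ∃ N, i ∈ I N) {μ ν : Measure (ι → E)} [IsFiniteMeasure μ] [IsFiniteMeasure ν]
    (h : ∀ N (x : ι → E), μ {f | ∀ i ∈ I N, f i = x i} = ν {f | ∀ i ∈ I N, f i = x i}) :
    μ = ν := by
  classical
  have key : ∀ J : Finset ι, μ.map J.restrict = ν.map J.restrict := by
    intro J
    obtain ⟨N, hN⟩ : ∃ N, J ⊆ I N := by
      induction J using Finset.induction_on with
      | empty => exact ⟨0, by simp⟩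
      | insert a s _ ih =>
        obtain ⟨N, hN⟩ := ih
        obtain ⟨M, hM⟩ := hcov a
        refine ⟨max N M, ?_⟩
        intro i hi
        rcases Finset.mem_insert.1 hi with rfl | hi
        · exact hI (le_max_right N M) hM
        · exact hI (le_max_left N M) (hN hi)
    have hbig : μ.map (I N).restrict = ν.map (I N).restrict := by
      refine Measure.ext_of_singleton fun y => ?_
      rw [Measure.map_apply (by fun_prop) (measurableSet_singleton _),
        Measure.map_apply (by fun_prop) (measurableSet_singleton _)]
      obtain ⟨e⟩ := ‹Nonempty E›
      have hset : (fun f : ι → E => (I N).restrict f) ⁻¹' {y} =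
          {f : ι → E | ∀ i ∈ I N, f i = (fun i => if hi : i ∈ I N then y ⟨i, hi⟩ else e) i} := by
        ext f
        simp only [Set.mem_preimage, Set.mem_singleton_iff, Set.mem_ofPred_eq, funext_iff,
          Subtype.forall, Finset.restrict]
        refine forall₂_congr fun i hi => ?_
        rw [dif_pos hi]
      rw [hset, h]
    have hcomp : (J.restrict : (ι → E) → _) = (Finset.restrict₂ hN) ∘ (I N).restrict := rfl
    rw [hcomp, ← Measure.map_map (by fun_prop) (by fun_prop),
      ← Measure.map_map (by fun_prop) (by fun_prop), hbig]
  have h1 : IsProjectiveLimit μ (fun J => μ.map J.restrict) := fun J => rfl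
  have h2 : IsProjectiveLimit ν (fun J => μ.map J.restrict) := fun J => (key J).symm
  exact h1.unique h2

/-- Windows of consecutive integers determine a finite measure on `ℤ → E`. -/
theorem ext_of_int_windows [Nonempty E] {μ ν : Measure (ℤ → E)} [IsFiniteMeasure μ]
    [IsFiniteMeasure ν]
    (h : ∀ (n : ℤ) (k : ℕ) (x : ℕ → E),
      μ {f | ∀ i ≤ k, f (n + (i : ℤ)) = x i} = ν {f | ∀ i ≤ k, f (n + (i : ℤ)) = x i}) :
    μ = ν := by
  refine ext_of_windows (fun N : ℕ => Finset.Icc (-(N : ℤ)) N) ?_ ?_ ?_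
  · intro a b hab
    exact Finset.Icc_subset_Icc (by simpa using hab) (by simpa using hab)
  · intro i
    exact ⟨i.natAbs, by simp only [Finset.mem_Icc]; omega⟩
  · intro N x
    have hset : {f : ℤ → E | ∀ i ∈ Finset.Icc (-(N : ℤ)) N, f i = x i} =
        {f | ∀ i ≤ 2 * N, f (-(N : ℤ) + (i : ℤ)) = (fun i : ℕ => x (-(N : ℤ) + i)) i} := by
      ext f
      simp only [Set.mem_ofPred_eq, Finset.mem_Icc]
      constructor
      · intro hf i hi
        exact hf _ ⟨by omega, by omega⟩
      · rintro hf i ⟨h1, h2⟩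
        have := hf (i + N).toNat (by omega)
        have e : (-(N : ℤ) + ((i + N).toNat : ℤ)) = i := by omega
        simpa only [e] using this
    rw [hset, h]

end Windows

/-! ### Doeblin contraction of stochastic matrices -/

section Contraction

variable {E : Type*} [Fintype E] [DecidableEq E] {Q : Matrix E E ℝ}

theorem sum_abs_vecMul_le (hQ : Q ∈ Matrix.rowStochastic ℝ E) (v : E → ℝ) :
    ∑ y, |(Matrix.vecMul v Q) y| ≤ ∑ x, |v x| := by
  obtain ⟨h0, h1⟩ := Matrix.mem_rowStochastic_iff_sum.1 hQ
  calc ∑ y, |(Matrix.vecMul v Q) y| ≤ ∑ y, ∑ x, |v x| * Q x y := by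
        refine Finset.sum_le_sum fun y _ => ?_
        refine (Finset.abs_sum_le_sum_abs _ _).trans (Finset.sum_le_sum fun x _ => ?_)
        rw [abs_mul, abs_of_nonneg (h0 x y)]
    _ = ∑ x, |v x| := by
        rw [Finset.sum_comm]
        refine Finset.sum_congr rfl fun x _ => ?_
        rw [← Finset.mul_sum, h1, mul_one]

theorem sum_vecMul (hQ : Q ∈ Matrix.rowStochastic ℝ E) (v : E → ℝ) :
    ∑ y, (Matrix.vecMul v Q) y = ∑ x, v x := by
  obtain ⟨h0, h1⟩ := Matrix.mem_rowStochastic_iff_sum.1 hQ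
  simp only [Matrix.vecMul, dotProduct]
  rw [Finset.sum_comm]
  refine Finset.sum_congr rfl fun x _ => ?_
  rw [← Finset.mul_sum, h1, mul_one]

/-- Doeblin's contraction. -/
theorem sum_abs_vecMul_le_of_column (hQ : Q ∈ Matrix.rowStochastic ℝ E) (e : E) {δ : ℝ}
    (hδ : ∀ x, δ ≤ Q x e) (v : E → ℝ) (hv : ∑ x, v x = 0) :
    ∑ y, |(Matrix.vecMul v Q) y| ≤ (1 - δ) * ∑ x, |v x| := by
  obtain ⟨h0, h1⟩ := Matrix.mem_rowStochastic_iff_sum.1 hQ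
  -- Lowering column `e` by `δ` does not change the action on vectors of zero sum, and leaves a
  -- nonnegative matrix with row sums `1 - δ`.
  have hsub : ∀ y, (Matrix.vecMul v Q) y = ∑ x, v x * (Q x y - if y = e then δ else 0) := by
    intro y
    simp only [mul_sub, Finset.sum_sub_distrib, ← Finset.sum_mul, hv, zero_mul, sub_zero]
    rfl
  calc ∑ y, |(Matrix.vecMul v Q) y|
      ≤ ∑ y, ∑ x, |v x| * (Q x y - if y = e then δ else 0) := by
        refine Finset.sum_le_sum fun y _ => ?_
        rw [hsub]
        refine (Finset.abs_sum_le_sum_abs _ _).trans (Finset.sum_le_sum fun x _ => ?_)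
        rw [abs_mul]
        refine le_of_eq ?_
        congr 1
        refine abs_of_nonneg ?_
        split_ifs with hy
        · subst hy
          linarith [hδ x]
        · simpa using h0 x y
    _ = (1 - δ) * ∑ x, |v x| := by
        rw [Finset.sum_comm, Finset.mul_sum]
        refine Finset.sum_congr rfl fun x _ => ?_
        rw [← Finset.mul_sum, Finset.sum_sub_distrib, h1]
        simp [mul_comm]

/-- A power of the stochastic matrix `Q` has a strictly positive column. -/
def IsDoeblin (Q : Matrix E E ℝ) : Prop :=
  ∃ (k : ℕ) (e : E), ∀ x, 0 < (Q ^ (k + 1)) x e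

/-- Each block of `k + 1` steps contracts by `1 - δ`, with `δ` the least entry of the positive
column; the remaining `m % (k + 1)` steps do not expand. -/
theorem exists_contraction_rate (hQ : Q ∈ Matrix.rowStochastic ℝ E) (hD : IsDoeblin Q) :
    ∃ r : ℕ → ℝ, Tendsto r atTop (𝓝 0) ∧ ∀ (m : ℕ) (v : E → ℝ), ∑ x, v x = 0 →
      ∑ y, |(Matrix.vecMul v (Q ^ m)) y| ≤ r m * ∑ x, |v x| := by
  obtain ⟨k, e, hk⟩ := hD
  have : Nonempty E := ⟨e⟩
  obtain ⟨x0, hx0⟩ := Finite.exists_min (fun x => (Q ^ (k + 1)) x e)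
  set δ := (Q ^ (k + 1)) x0 e with hδ
  have hRs : ∀ m, Q ^ m ∈ Matrix.rowStochastic ℝ E := fun m => pow_mem hQ m
  have hδ1 : δ ≤ 1 := by
    obtain ⟨h0, h1⟩ := Matrix.mem_rowStochastic_iff_sum.1 (hRs (k + 1))
    rw [← h1 x0]
    exact Finset.single_le_sum (f := fun y => (Q ^ (k + 1)) x0 y) (fun y _ => h0 x0 y)
      (Finset.mem_univ e)
  have hmul : ∀ (j : ℕ) (v : E → ℝ), ∑ x, v x = 0 →
      ∑ y, |(Matrix.vecMul v (Q ^ ((k + 1) * j))) y| ≤ (1 - δ) ^ j * ∑ x, |v x| := by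
    intro j
    induction j with
    | zero => intro v _; simp
    | succ j ih =>
      intro v hv
      rw [mul_add, mul_one, pow_add, ← Matrix.vecMul_vecMul]
      refine (sum_abs_vecMul_le_of_column (hRs _) e hx0 _ ?_).trans ?_
      · rw [sum_vecMul (hRs _), hv]
      · rw [pow_succ', mul_assoc]
        exact mul_le_mul_of_nonneg_left (ih v hv) (by linarith)
  refine ⟨fun m => (1 - δ) ^ (m / (k + 1)), ?_, ?_⟩
  · exact (tendsto_pow_atTop_nhds_zero_of_lt_one (by linarith) (by linarith [hk x0])).comp
      (Nat.tendsto_div_const_atTop (by omega))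
  · intro m v hv
    conv_lhs => rw [← Nat.div_add_mod m (k + 1), pow_add, ← Matrix.vecMul_vecMul]
    exact (sum_abs_vecMul_le (hRs _) _).trans (hmul _ v hv)

end Contraction

/-! ### Two-sided Markov chains: past events and mixing -/

/-- The event `B` only involves the coordinates up to `n`. -/
def IsPast {E : Type*} (n : ℤ) (B : Set (ℤ → E)) : Prop :=
  ∀ f g : ℤ → E, (∀ i ≤ n, f i = g i) → f ∈ B → g ∈ B

theorem IsPast.mono {E : Type*} {n m : ℤ} {B : Set (ℤ → E)} (h : IsPast n B) (hnm : n ≤ m) :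
    IsPast m B := fun f g hfg => h f g fun i hi => hfg i (hi.trans hnm)

theorem IsPast.inter {E : Type*} {n : ℤ} {A B : Set (ℤ → E)} (hA : IsPast n A)
    (hB : IsPast n B) : IsPast n (A ∩ B) :=
  fun f g hfg hf => ⟨hA f g hfg hf.1, hB f g hfg hf.2⟩

theorem isPast_window {E : Type*} (n : ℤ) (k : ℕ) (x : ℕ → E) :
    IsPast (n + k) {f : ℤ → E | ∀ i ≤ k, f (n + (i : ℤ)) = x i} :=
  fun f g hfg hf i hi => by rw [← hfg _ (by omega)]; exact hf i hi

section Markov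

variable {Ω E : Type*} [MeasurableSpace Ω] [MeasurableSpace E] {P : Measure Ω}

/-- The law of a two-sided process does not change under the shift. -/
theorem map_shift_eq {X : Ω → ℤ → E} (hm : Measurable X)
    (hs : P.map (fun ω n => X ω (n + 1)) = P.map X) (k : ℤ) :
    P.map (fun ω n => X ω (n + k)) = P.map X := by
  have hcomp : ∀ a b : ℤ, P.map (fun ω n => X ω (n + a)) = P.map X →
      P.map (fun ω n => X ω (n + a + b)) = P.map (fun ω n => X ω (n + b)) := by
    intro a b h
    have hφ : Measurable fun (f : ℤ → E) (n : ℤ) => f (n + b) := by fun_prop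
    have := congrArg (fun ν => ν.map fun (f : ℤ → E) (n : ℤ) => f (n + b)) h
    rw [Measure.map_map hφ (by fun_prop), Measure.map_map hφ hm] at this
    have e : (fun ω n => X ω (n + a + b)) =
        (fun (f : ℤ → E) (n : ℤ) => f (n + b)) ∘ fun ω n => X ω (n + a) := by
      funext ω n
      simp only [Function.comp]
      congr 1
      ring
    rw [e, this]
    rfl
  have hneg : P.map (fun ω n => X ω (n + -1)) = P.map X := by
    have := hcomp 1 (-1) hs
    simpa using this.symm
  induction k using Int.induction_on with
  | zero => simp
  | succ i ih =>
    have := hcomp i 1 ih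
    rw [hs] at this
    simpa [add_assoc] using this
  | pred i ih =>
    have := hcomp (-i) (-1) ih
    rw [hneg] at this
    simpa [add_assoc, sub_eq_add_neg] using this

theorem measure_shift_eq {X : Ω → ℤ → E} (hm : Measurable X)
    (hs : P.map (fun ω n => X ω (n + 1)) = P.map X) (k : ℤ) {B : Set (ℤ → E)}
    (hB : MeasurableSet B) :
    P.real {ω | (fun n => X ω (n + k)) ∈ B} = P.real {ω | X ω ∈ B} := by
  have h := congrArg (fun ν => ν.real B) (map_shift_eq hm hs k)
  rw [map_measureReal_apply (by fun_prop) hB, map_measureReal_apply hm hB] at h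
  exact h

theorem IsStationaryMarkovChain.coord [MeasurableSingletonClass E] {X : Ω → ℤ → E}
    {Q : Matrix E E ℝ} (hX : IsStationaryMarkovChain P X Q) (n : ℤ) (x : E) :
    P.real {ω | X ω n = x} = P.real {ω | X ω 0 = x} := by
  have := measure_shift_eq hX.measurable hX.stationary n (measurableSet_coord 0 x)
  simpa using this

theorem measurableSet_preimage_coord [MeasurableSingletonClass E] {X : Ω → ℤ → E}
    (hX : Measurable X) (n : ℤ) (x : E) :
    MeasurableSet {ω | X ω n = x} := hX (measurableSet_coord n x)

/-- Decomposition of an event according to the value of one coordinate. -/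
theorem sum_measureReal_coord [Fintype E] [MeasurableSingletonClass E]
    [IsFiniteMeasure P] {X : Ω → ℤ → E} (hX : Measurable X) (n : ℤ) (S : Set Ω) :
    ∑ x, P.real {ω | ω ∈ S ∧ X ω n = x} = P.real S := by
  have hfib : ∀ x, MeasurableSet {ω | X ω n = x} := measurableSet_preimage_coord hX n
  have hc : Measurable fun ω => X ω n := by fun_prop
  have h : ∀ T : Set E, ((P.restrict S).map (fun ω => X ω n)).real T =
      P.real {ω | ω ∈ S ∧ X ω n ∈ T} := by
    intro T
    have hT : MeasurableSet T := T.toFinite.measurableSet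
    rw [map_measureReal_apply hc hT, measureReal_restrict_apply (hc hT)]
    congr 1
    ext ω
    simp [and_comm]
  have h1 := sum_measureReal_singleton (μ := (P.restrict S).map (fun ω => X ω n)) Finset.univ
  simp only [h, Finset.coe_univ, Set.mem_univ, and_true, Set.mem_singleton_iff] at h1
  exact h1

end Markov

section Markov

variable {Ω E : Type*} [MeasurableSpace Ω] [Fintype E] [DecidableEq E] [MeasurableSpace E]
  [MeasurableSingletonClass E] {P : Measure Ω} [IsProbabilityMeasure P] {X : Ω → ℤ → E}
  {Q : Matrix E E ℝ}

/-- The Markov property, conditionally on the whole past. -/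
theorem IsStationaryMarkovChain.past (hX : IsStationaryMarkovChain P X Q)
    (hQ : ∀ x y, 0 ≤ Q x y) {n : ℤ} {B : Set (ℤ → E)} (hB : MeasurableSet B) (hBn : IsPast n B)
    (x y : E) :
    P.real {ω | X ω ∈ B ∧ X ω n = x ∧ X ω (n + 1) = y} =
      P.real {ω | X ω ∈ B ∧ X ω n = x} * Q x y := by
  have : Nonempty E := ⟨x⟩
  have hXm := hX.measurable
  have hc : ∀ i, Measurable fun ω => X ω i := fun i => by fun_prop
  have hms : ∀ i z, MeasurableSet {ω | X ω i = z} := fun i z => hc i (measurableSet_singleton z)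
  -- Read backwards from `n`, the past is indexed by `ℕ`; its initial segments exhaust it, and each
  -- of them, completed by time `n + 1`, is a window of the Markov property.
  let past : Ω → ℕ → E := fun ω j => X ω (n - j)
  have hpast : Measurable past := by fun_prop
  let μ : Measure (ℕ → E) := (P.restrict {ω | X ω n = x ∧ X ω (n + 1) = y}).map past
  let ν : Measure (ℕ → E) := ENNReal.ofReal (Q x y) • (P.restrict {ω | X ω n = x}).map past
  have : IsFiniteMeasure ν := by
    have : IsFiniteMeasure ((P.restrict {ω | X ω n = x}).map past) := inferInstance
    exact Measure.smul_finite _ ENNReal.ofReal_ne_top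
  have hμ : ∀ S, MeasurableSet S →
      μ.real S = P.real {ω | past ω ∈ S ∧ X ω n = x ∧ X ω (n + 1) = y} := by
    intro S hS
    rw [map_measureReal_apply hpast hS, measureReal_restrict_apply (hpast hS)]
    rfl
  have hν : ∀ S, MeasurableSet S →
      ν.real S = P.real {ω | past ω ∈ S ∧ X ω n = x} * Q x y := by
    intro S hS
    rw [measureReal_ennreal_smul_apply, map_measureReal_apply hpast hS,
      measureReal_restrict_apply (hpast hS), ENNReal.toReal_ofReal (hQ x y), mul_comm]
    rfl
  have hμν : μ = ν := by
    refine ext_of_windows (fun N => Finset.range (N + 1)) ?_ ?_ ?_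
    · intro a b hab
      exact Finset.range_mono (by omega)
    · exact fun i => ⟨i, by simp⟩
    · intro N z
      have hSm : MeasurableSet {f : ℕ → E | ∀ i ∈ Finset.range (N + 1), f i = z i} := by
        have : {f : ℕ → E | ∀ i ∈ Finset.range (N + 1), f i = z i} =
            ⋂ i ∈ Finset.range (N + 1), (fun f : ℕ → E => f i) ⁻¹' {z i} := by
          ext f; simp
        rw [this]
        exact Finset.measurableSet_biInter _ fun i _ =>
          measurable_pi_apply i (measurableSet_singleton _)
      rw [← measureReal_eq_measureReal_iff, hμ _ hSm, hν _ hSm]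
      by_cases hz : z 0 = x
      · set w : ℕ → E := fun i => if i = N + 1 then y else z (N - i) with hw
        have h := hX.markov (n - N) N w
        have e1 : {ω | past ω ∈ {f : ℕ → E | ∀ i ∈ Finset.range (N + 1), f i = z i} ∧
            X ω n = x ∧ X ω (n + 1) = y} =
            {ω | ∀ i ≤ N + 1, X ω (n - N + (i : ℤ)) = w i} := by
          ext ω
          simp only [Set.mem_ofPred_eq, Finset.mem_range, past, hw]
          constructor
          · rintro ⟨h1, h2, h3⟩ i hi
            split_ifs with hiN
            · subst hiN
              rw [← h3]; congr 1; push_cast; ring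
            · rw [← h1 (N - i) (by omega)]; congr 1; omega
          · intro h1
            refine ⟨fun i hi => ?_, ?_, ?_⟩
            · have := h1 (N - i) (by omega)
              rw [if_neg (by omega)] at this
              convert this using 2 <;> omega
            · have := h1 N (by omega)
              rw [if_neg (by omega)] at this
              simp only [sub_add_cancel, Nat.sub_self] at this
              rw [this, hz]
            · have := h1 (N + 1) le_rfl
              rw [if_pos rfl] at this
              convert this using 2
              push_cast; ring
        have e2 : {ω | past ω ∈ {f : ℕ → E | ∀ i ∈ Finset.range (N + 1), f i = z i} ∧
            X ω n = x} = {ω | ∀ i ≤ N, X ω (n - N + (i : ℤ)) = w i} := by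
          ext ω
          simp only [Set.mem_ofPred_eq, Finset.mem_range, past, hw]
          constructor
          · rintro ⟨h1, h2⟩ i hi
            rw [if_neg (by omega), ← h1 (N - i) (by omega)]
            congr 1; omega
          · intro h1
            refine ⟨fun i hi => ?_, ?_⟩
            · have := h1 (N - i) (by omega)
              rw [if_neg (by omega)] at this
              convert this using 2 <;> omega
            · have := h1 N (by omega)
              rw [if_neg (by omega)] at this
              simp only [sub_add_cancel, Nat.sub_self] at this
              rw [this, hz]
        rw [e1, e2, h]
        simp [hw, hz]
      · have key : ∀ ω, past ω ∈ {f : ℕ → E | ∀ i ∈ Finset.range (N + 1), f i = z i} →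
            X ω n ≠ x := by
          intro ω h1 h2
          have := h1 0 (by simp)
          simp only [past, Nat.cast_zero, sub_zero] at this
          exact hz (this.symm.trans h2)
        have e1 : {ω | past ω ∈ {f : ℕ → E | ∀ i ∈ Finset.range (N + 1), f i = z i} ∧
            X ω n = x ∧ X ω (n + 1) = y} = ∅ := by
          ext ω
          simp only [Set.mem_ofPred_eq, Set.mem_empty_iff_false, iff_false]
          exact fun h => key ω h.1 h.2.1
        have e2 : {ω | past ω ∈ {f : ℕ → E | ∀ i ∈ Finset.range (N + 1), f i = z i} ∧
            X ω n = x} = ∅ := by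
          ext ω
          simp only [Set.mem_ofPred_eq, Set.mem_empty_iff_false, iff_false]
          exact fun h => key ω h.1 h.2
        rw [e1, e2]
        simp
  -- To the right of `n` the truncation `toNat` repeats the value at `n`; this is harmless because
  -- `B` does not look there.
  let ext : (ℕ → E) → ℤ → E := fun g i => g (n - i).toNat
  have hext : Measurable ext := by fun_prop
  have hBe : ∀ ω, past ω ∈ ext ⁻¹' B ↔ X ω ∈ B := by
    intro ω
    have : ∀ i ≤ n, ext (past ω) i = X ω i := by
      intro i hi
      simp only [ext, past]
      congr 1; omega
    exact ⟨hBn _ _ this, hBn _ _ fun i hi => (this i hi).symm⟩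
  have h1 := hμ _ (hext hB)
  have h2 := hν _ (hext hB)
  rw [hμν, h2] at h1
  simp only [hBe] at h1
  exact h1.symm

theorem IsStationaryMarkovChain.past_vecMul (hX : IsStationaryMarkovChain P X Q)
    (hQ : ∀ x y, 0 ≤ Q x y) {n : ℤ} {B : Set (ℤ → E)} (hB : MeasurableSet B) (hBn : IsPast n B) :
    (fun y => P.real {ω | X ω ∈ B ∧ X ω (n + 1) = y}) =
      Matrix.vecMul (fun x => P.real {ω | X ω ∈ B ∧ X ω n = x}) Q := by
  funext y
  rw [← sum_measureReal_coord (P := P) hX.measurable n]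
  simp only [Matrix.vecMul, dotProduct]
  refine Finset.sum_congr rfl fun x _ => ?_
  rw [← hX.past hQ hB hBn]
  congr 1
  ext ω
  simp only [Set.mem_ofPred_eq]
  tauto

theorem IsStationaryMarkovChain.past_vecMul_pow (hX : IsStationaryMarkovChain P X Q)
    (hQ : ∀ x y, 0 ≤ Q x y) {n : ℤ} {B : Set (ℤ → E)} (hB : MeasurableSet B) (hBn : IsPast n B)
    (m : ℕ) :
    (fun y => P.real {ω | X ω ∈ B ∧ X ω (n + m) = y}) =
      Matrix.vecMul (fun x => P.real {ω | X ω ∈ B ∧ X ω n = x}) (Q ^ m) := by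
  induction m with
  | zero => simp
  | succ m ih =>
    rw [pow_succ, ← Matrix.vecMul_vecMul, ← ih,
      ← hX.past_vecMul hQ hB (hBn.mono (by omega : n ≤ n + m))]
    simp [add_assoc]

/-- The past and the far future of the chain are asymptotically independent, uniformly. -/
theorem IsStationaryMarkovChain.exists_mixing_rate (hX : IsStationaryMarkovChain P X Q)
    (hQ : Q ∈ Matrix.rowStochastic ℝ E) (hD : IsDoeblin Q) :
    ∃ r : ℕ → ℝ, Tendsto r atTop (𝓝 0) ∧ ∀ (n : ℤ) (B : Set (ℤ → E)), MeasurableSet B →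
      IsPast n B → ∀ (m : ℕ) (y : E),
        |P.real {ω | X ω ∈ B ∧ X ω (n + m) = y} -
          P.real {ω | X ω ∈ B} * P.real {ω | X ω 0 = y}| ≤ r m := by
  have hQ0 : ∀ x y, 0 ≤ Q x y := (Matrix.mem_rowStochastic_iff_sum.1 hQ).1
  obtain ⟨r, hr, hrate⟩ := exists_contraction_rate hQ hD
  refine ⟨fun m => |r m| * 2, by simpa using (hr.abs.mul_const 2), ?_⟩
  intro n B hB hBn m y
  set π : E → ℝ := fun y => P.real {ω | X ω 0 = y} with hπ
  set v : E → ℝ := fun y => P.real {ω | X ω ∈ B ∧ X ω n = y} with hv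
  have hπQ : Matrix.vecMul π (Q ^ m) = π := by
    have h := hX.past_vecMul_pow hQ0 (B := Set.univ) (n := n) MeasurableSet.univ
      (fun _ _ _ _ => trivial) m
    simp only [Set.mem_univ, true_and, hX.coord] at h
    exact h.symm
  have hsv : ∑ x, v x = P.real {ω | X ω ∈ B} := sum_measureReal_coord hX.measurable n _
  have hsπ : ∑ x, π x = 1 := by
    have := sum_measureReal_coord (P := P) hX.measurable 0 Set.univ
    simpa using this
  have hb0 : 0 ≤ P.real {ω | X ω ∈ B} := measureReal_nonneg
  have hb1 : P.real {ω | X ω ∈ B} ≤ 1 := measureReal_le_one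
  -- Since `π` is stationary, `u` has zero sum and its image under `Q ^ m` is the quantity to bound.
  set u : E → ℝ := v - P.real {ω | X ω ∈ B} • π with hu
  have hu0 : ∑ x, u x = 0 := by
    simp [hu, Finset.sum_sub_distrib, ← Finset.mul_sum, hsv, hsπ]
  have hu1 : ∑ x, |u x| ≤ 2 := by
    calc ∑ x, |u x| ≤ ∑ x, (v x + P.real {ω | X ω ∈ B} * π x) := by
          refine Finset.sum_le_sum fun x _ => ?_
          have h1 : 0 ≤ v x := measureReal_nonneg
          have h2 : 0 ≤ P.real {ω | X ω ∈ B} * π x := mul_nonneg hb0 measureReal_nonneg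
          simp only [hu, Pi.sub_apply, Pi.smul_apply, smul_eq_mul]
          rw [abs_le]
          constructor <;> linarith
      _ ≤ 2 := by
          rw [Finset.sum_add_distrib, ← Finset.mul_sum, hsv, hsπ]
          linarith
  have huQ : Matrix.vecMul u (Q ^ m) y = P.real {ω | X ω ∈ B ∧ X ω (n + m) = y} -
      P.real {ω | X ω ∈ B} * π y := by
    rw [hu, Matrix.sub_vecMul, Matrix.smul_vecMul, hπQ, ← hX.past_vecMul_pow hQ0 hB hBn m]
    rfl
  rw [← huQ]
  calc |Matrix.vecMul u (Q ^ m) y| ≤ ∑ z, |Matrix.vecMul u (Q ^ m) z| :=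
        Finset.single_le_sum (f := fun z => |Matrix.vecMul u (Q ^ m) z|)
          (fun _ _ => abs_nonneg _) (Finset.mem_univ y)
    _ ≤ r m * ∑ x, |u x| := hrate m u hu0
    _ ≤ |r m| * ∑ x, |u x| :=
        mul_le_mul_of_nonneg_right (le_abs_self _) (Finset.sum_nonneg fun _ _ => abs_nonneg _)
    _ ≤ |r m| * 2 := mul_le_mul_of_nonneg_left hu1 (abs_nonneg _)

theorem IsStationaryMarkovChain.tendsto_past (hX : IsStationaryMarkovChain P X Q)
    (hQ : Q ∈ Matrix.rowStochastic ℝ E) (hD : IsDoeblin Q) {n : ℤ} {B : Set (ℤ → E)}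
    (hB : MeasurableSet B) (hBn : IsPast n B) (y : E) :
    Tendsto (fun m : ℕ => P.real {ω | X ω ∈ B ∧ X ω (n + m) = y}) atTop
      (𝓝 (P.real {ω | X ω ∈ B} * P.real {ω | X ω 0 = y})) := by
  obtain ⟨r, hr, hrate⟩ := hX.exists_mixing_rate hQ hD
  rw [tendsto_iff_dist_tendsto_zero]
  exact squeeze_zero (fun _ => dist_nonneg) (fun m => hrate n B hB hBn m y) hr

end Markov

/-! ### Triviality of the remote past -/

section TailTrivial

theorem abs_measureReal_inter_sub_le {Ω : Type*} [MeasurableSpace Ω] {P : Measure Ω}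
    [IsFiniteMeasure P] {S T : Set Ω} (hS : MeasurableSet S) (hT : MeasurableSet T) {U : Set Ω}
    (hU : MeasurableSet U) :
    |P.real (S ∩ U) - P.real (T ∩ U)| ≤ P.real (symmDiff S T) := by
  refine (abs_measureReal_sub_le_measureReal_symmDiff (hS.inter hU).nullMeasurableSet
    (hT.inter hU).nullMeasurableSet).trans (measureReal_mono ?_)
  intro ω
  simp only [Set.mem_symmDiff, Set.mem_inter_iff]
  tauto

variable {Ω E : Type*} [MeasurableSpace Ω] [Fintype E] [DecidableEq E] [MeasurableSpace E]
  [MeasurableSingletonClass E] {P : Measure Ω} [IsProbabilityMeasure P] {X : Ω → ℤ → E}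
  {Q : Matrix E E ℝ}

/-- An event that can be approximated by events from the arbitrarily remote past is trivial. -/
theorem IsStationaryMarkovChain.measureReal_eq_zero_or_one (hX : IsStationaryMarkovChain P X Q)
    (hQ : Q ∈ Matrix.rowStochastic ℝ E) (hD : IsDoeblin Q) {B : Set (ℤ → E)}
    (hB : MeasurableSet B)
    (happ : ∀ (n : ℤ) (ε : ℝ), 0 < ε → ∃ B' : Set (ℤ → E), MeasurableSet B' ∧ IsPast n B' ∧
      P.real (symmDiff (X ⁻¹' B) (X ⁻¹' B')) ≤ ε) :
    P.real (X ⁻¹' B) = 0 ∨ P.real (X ⁻¹' B) = 1 := by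
  have hXm := hX.measurable
  have hQ0 : ∀ x y, 0 ≤ Q x y := (Matrix.mem_rowStochastic_iff_sum.1 hQ).1
  obtain ⟨r, hr, hrate⟩ := hX.exists_mixing_rate hQ hD
  have hclose : ∀ {B' U : Set (ℤ → E)}, MeasurableSet B' → MeasurableSet U →
      |P.real (X ⁻¹' B ∩ X ⁻¹' U) - P.real (X ⁻¹' B' ∩ X ⁻¹' U)| ≤
        P.real (symmDiff (X ⁻¹' B) (X ⁻¹' B')) :=
    fun hB' hU => abs_measureReal_inter_sub_le (hXm hB) (hXm hB') (hXm hU)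
  -- Restricted to `B`, the process is still Markov with the same transitions: for an approximation
  -- `B'` in the past of `n` this is `past`, and the error is arbitrarily small.
  have hmarkov : ∀ (n : ℤ) (k : ℕ) (x : ℕ → E),
      P.real (X ⁻¹' B ∩ X ⁻¹' {f | ∀ i ≤ k + 1, f (n + (i : ℤ)) = x i}) =
      P.real (X ⁻¹' B ∩ X ⁻¹' {f | ∀ i ≤ k, f (n + (i : ℤ)) = x i}) * Q (x k) (x (k + 1)) := by
    intro n k x
    have hQle : Q (x k) (x (k + 1)) ≤ 1 := Matrix.le_one_of_mem_rowStochastic hQ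
    refine eq_of_abs_sub_le_all fun ε hε => ?_
    obtain ⟨B', hB', hB'n, hle⟩ := happ n (ε / 2) (by positivity)
    have h := hX.past hQ0 (n := n + k) (hB'.inter (measurableSet_window n k x))
      ((hB'n.mono (by omega)).inter (isPast_window n k x)) (x k) (x (k + 1))
    have e1 : {ω | X ω ∈ B' ∩ {f | ∀ i ≤ k, f (n + (i : ℤ)) = x i} ∧ X ω (n + k) = x k ∧
        X ω (n + k + 1) = x (k + 1)} =
        X ⁻¹' B' ∩ X ⁻¹' {f | ∀ i ≤ k + 1, f (n + (i : ℤ)) = x i} := by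
      ext ω
      simp only [Set.mem_ofPred_eq, Set.mem_inter_iff, Set.mem_preimage]
      constructor
      · rintro ⟨⟨h1, h2⟩, -, h3⟩
        refine ⟨h1, fun i hi => ?_⟩
        rcases Nat.lt_or_ge k i with hk | hk
        · obtain rfl : i = k + 1 := by omega
          rw [← h3]; congr 1; push_cast; ring
        · exact h2 i hk
      · rintro ⟨h1, h2⟩
        refine ⟨⟨h1, fun i hi => h2 i (by omega)⟩, h2 k (by omega), ?_⟩
        rw [← h2 (k + 1) le_rfl]; congr 1; push_cast; ring
    have e2 : {ω | X ω ∈ B' ∩ {f | ∀ i ≤ k, f (n + (i : ℤ)) = x i} ∧ X ω (n + k) = x k} =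
        X ⁻¹' B' ∩ X ⁻¹' {f | ∀ i ≤ k, f (n + (i : ℤ)) = x i} := by
      ext ω
      simp only [Set.mem_ofPred_eq, Set.mem_inter_iff, Set.mem_preimage]
      exact ⟨fun h => h.1, fun h => ⟨h, h.2 k le_rfl⟩⟩
    rw [e1, e2] at h
    have h1 := (hclose hB' (measurableSet_window n (k + 1) x)).trans hle
    have h2 := (hclose hB' (measurableSet_window n k x)).trans hle
    rw [abs_le] at h1 h2 ⊢
    have := hQ0 (x k) (x (k + 1))
    constructor <;> nlinarith
  -- Restricted to `B`, the one-time marginals are still the stationary law up to the factor `P B`: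
  -- the approximation may be taken `m` steps in the past, for every `m`.
  have hone : ∀ (n : ℤ) (y : E), P.real (X ⁻¹' B ∩ X ⁻¹' {f | f n = y}) =
      P.real (X ⁻¹' B) * P.real {ω | X ω 0 = y} := by
    intro n y
    have hpi : P.real {ω | X ω 0 = y} ≤ 1 := measureReal_le_one
    have hpi0 : 0 ≤ P.real {ω | X ω 0 = y} := measureReal_nonneg
    have hm : ∀ m, |P.real (X ⁻¹' B ∩ X ⁻¹' {f | f n = y}) -
        P.real (X ⁻¹' B) * P.real {ω | X ω 0 = y}| ≤ r m := by
      intro m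
      refine le_of_forall_pos_le_add fun ε hε => ?_
      obtain ⟨B', hB', hB'n, hle⟩ := happ (n - m) (ε / 2) (by positivity)
      have h := hrate (n - m) B' hB' hB'n m y
      rw [sub_add_cancel] at h
      have h1 := (hclose hB' (measurableSet_coord n y)).trans hle
      have h2 := (hclose hB' MeasurableSet.univ).trans hle
      simp only [Set.preimage_univ, Set.inter_univ] at h2
      have e1 : {ω | X ω ∈ B' ∧ X ω n = y} = X ⁻¹' B' ∩ X ⁻¹' {f | f n = y} := rfl
      have e2 : {ω | X ω ∈ B'} = X ⁻¹' B' := rfl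
      rw [e1, e2] at h
      rw [abs_le] at h h1 h2 ⊢
      constructor <;> nlinarith
    have h0 := ge_of_tendsto' hr hm
    have := abs_nonneg (P.real (X ⁻¹' B ∩ X ⁻¹' {f | f n = y}) -
        P.real (X ⁻¹' B) * P.real {ω | X ω 0 = y})
    exact sub_eq_zero.1 (abs_eq_zero.1 (le_antisymm h0 this))
  have hwin : ∀ (n : ℤ) (k : ℕ) (x : ℕ → E),
      P.real (X ⁻¹' B ∩ X ⁻¹' {f | ∀ i ≤ k, f (n + (i : ℤ)) = x i}) =
      P.real (X ⁻¹' B) * P.real (X ⁻¹' {f | ∀ i ≤ k, f (n + (i : ℤ)) = x i}) := by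
    intro n k x
    induction k with
    | zero =>
      have := hone n (x 0)
      rw [← hX.coord n] at this
      simpa using this
    | succ k ih =>
      have h2 := hX.markov n k x
      rw [hmarkov, ih, mul_assoc]
      congr 1
      exact h2.symm
  have hE : Nonempty E := by
    obtain ⟨ω⟩ : Nonempty Ω := nonempty_of_isProbabilityMeasure P
    exact ⟨X ω 0⟩
  -- So the whole process is independent of `B`; testing this on `B` itself gives `P B = P B ^ 2`.
  have hlaw : (P.restrict (X ⁻¹' B)).map X = P (X ⁻¹' B) • P.map X := by
    have : IsFiniteMeasure (P (X ⁻¹' B) • P.map X) :=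
      Measure.smul_finite _ (measure_ne_top _ _)
    refine ext_of_int_windows fun n k x => ?_
    have hw := measurableSet_window n k x
    rw [← measureReal_eq_measureReal_iff, measureReal_ennreal_smul_apply,
      map_measureReal_apply hXm hw, map_measureReal_apply hXm hw,
      measureReal_restrict_apply (hXm hw), Set.inter_comm]
    exact hwin n k x
  have h := congrArg (fun ν => ν.real B) hlaw
  rw [measureReal_ennreal_smul_apply, map_measureReal_apply hXm hB, map_measureReal_apply hXm hB,
    measureReal_restrict_apply (hXm hB), Set.inter_self] at h
  change _ = P.real (X ⁻¹' B) * _ at h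
  have : P.real (X ⁻¹' B) * (P.real (X ⁻¹' B) - 1) = 0 := by linarith
  rcases mul_eq_zero.1 this with h | h
  · exact Or.inl h
  · exact Or.inr (by linarith)

end TailTrivial

theorem fin_two_cases (a : Fin 2) : a = 0 ∨ a = 1 := by omega

/-! ### The carrier and the local rule of the dynamics -/

section Carrier

/-- The carrier `W = M - S`. -/
noncomputable def carrier (η : Config) (n : ℤ) : ℤ :=
  pastMax (pathEncoding η) n - pathEncoding η n

/-- The normalization `S 0 = 0` spoils shift covariance of the path but not of its increments.
Taking `k = 0` yields dependence on the past only; a general `k` yields covariance under shifts. -/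
theorem pathEncoding_sub_congr {η ξ : Config} {n k : ℤ} (h : ∀ i ≤ n, ξ i = η (i + k)) {m : ℤ}
    (hm : m ≤ n) :
    pathEncoding ξ m - pathEncoding ξ n = pathEncoding η (m + k) - pathEncoding η (n + k) := by
  induction m, hm using Int.leInductionDown with
  | base => simp
  | pred m hm ih =>
    have h1 := pathEncoding_step ξ m
    have h2 := pathEncoding_step η (m + k)
    rw [h m hm] at h1
    have e : m - 1 + k = m + k - 1 := by ring
    rw [e]
    linarith

variable {η ξ : Config}

theorem BBSDefined.bddAbove (h : BBSDefined η) (n : ℤ) :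
    BddAbove (pathEncoding η '' Set.Iic n) := by
  have hsub : Set.Iic n ⊆ Set.Iic 0 ∪ Set.Icc 0 n := by
    intro i hi
    rcases le_total i 0 with h0 | h0
    · exact Or.inl h0
    · exact Or.inr ⟨h0, hi⟩
  refine BddAbove.mono (Set.image_mono hsub) ?_
  rw [Set.image_union]
  exact BddAbove.union h ((Set.finite_Icc 0 n).image _).bddAbove

theorem BBSDefined.of_bddAbove {n : ℤ} (h : BddAbove (pathEncoding η '' Set.Iic n)) :
    BBSDefined η := by
  have hsub : Set.Iic 0 ⊆ Set.Iic n ∪ Set.Icc n 0 := by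
    intro i hi
    rcases le_total i n with h0 | h0
    · exact Or.inl h0
    · exact Or.inr ⟨h0, hi⟩
  refine BddAbove.mono (Set.image_mono hsub) ?_
  rw [Set.image_union]
  exact BddAbove.union h ((Set.finite_Icc n 0).image _).bddAbove

theorem BBSDefined.isGreatest_pastMax (h : BBSDefined η) (n : ℤ) :
    IsGreatest (pathEncoding η '' Set.Iic n) (pastMax (pathEncoding η) n) :=
  ⟨Int.csSup_mem (Set.nonempty_Iic.image _) (h.bddAbove n), fun _ hx => le_csSup (h.bddAbove n) hx⟩

theorem BBSDefined.isGreatest_carrier (h : BBSDefined η) (n : ℤ) :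
    IsGreatest ((fun m => pathEncoding η m - pathEncoding η n) '' Set.Iic n) (carrier η n) := by
  obtain ⟨⟨m, hm, h1⟩, h2⟩ := h.isGreatest_pastMax n
  refine ⟨⟨m, hm, by simp only [carrier, h1]⟩, ?_⟩
  rintro _ ⟨i, hi, rfl⟩
  have := h2 ⟨i, hi, rfl⟩
  simp only [carrier]
  linarith

theorem BBSDefined.congr (h : BBSDefined η) {n k : ℤ} (hc : ∀ i ≤ n, ξ i = η (i + k)) :
    BBSDefined ξ := by
  obtain ⟨b, hb⟩ := h.bddAbove (n + k)
  refine BBSDefined.of_bddAbove (n := n)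
    ⟨b + pathEncoding ξ n - pathEncoding η (n + k), ?_⟩
  rintro _ ⟨m, hm, rfl⟩
  have h1 := pathEncoding_sub_congr hc hm
  have h2 := hb ⟨m + k, by simpa using hm, rfl⟩
  linarith

theorem BBSDefined.carrier_congr (h : BBSDefined η) {n k : ℤ}
    (hc : ∀ i ≤ n, ξ i = η (i + k)) : carrier ξ n = carrier η (n + k) := by
  have h1 := (h.congr hc).isGreatest_carrier n
  have h2 := h.isGreatest_carrier (n + k)
  have e : ((fun m => pathEncoding ξ m - pathEncoding ξ n) '' Set.Iic n) =
      (fun m => pathEncoding η m - pathEncoding η (n + k)) '' Set.Iic (n + k) := by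
    ext z
    constructor
    · rintro ⟨m, hm, rfl⟩
      exact ⟨m + k, by simpa using hm, (pathEncoding_sub_congr hc hm).symm⟩
    · rintro ⟨m, hm, rfl⟩
      have hm' : m - k ≤ n := by simp only [Set.mem_Iic] at hm; linarith
      refine ⟨m - k, hm', ?_⟩
      have := pathEncoding_sub_congr hc hm'
      rwa [sub_add_cancel] at this
  rw [e] at h1
  exact h1.unique h2

theorem BBSDefined.carrier_nonneg (h : BBSDefined η) (n : ℤ) : 0 ≤ carrier η n :=
  (h.isGreatest_carrier n).2 ⟨n, Set.mem_Iic.2 le_rfl, by simp⟩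

theorem BBSDefined.pastMax_step (h : BBSDefined η) (n : ℤ) :
    pastMax (pathEncoding η) n = max (pastMax (pathEncoding η) (n - 1)) (pathEncoding η n) := by
  have h1 := h.isGreatest_pastMax n
  have h2 := (h.isGreatest_pastMax (n - 1)).insert (pathEncoding η n)
  have e : Set.Iic n = insert n (Set.Iic (n - 1)) := by
    ext i; simp only [Set.mem_Iic, Set.mem_insert_iff]; omega
  rw [e, Set.image_insert_eq] at h1
  rw [h1.unique h2, max_comm]

theorem BBSDefined.carrier_step (h : BBSDefined η) (n : ℤ) :
    carrier η n = max (carrier η (n - 1) + 2 * ((η n : ℕ) : ℤ) - 1) 0 := by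
  have h1 := h.pastMax_step n
  have h2 := pathEncoding_step η n
  simp only [carrier]
  omega

theorem BBSDefined.carrier_step_one (h : BBSDefined η) {n : ℤ} (hn : η n = 1) :
    carrier η n = carrier η (n - 1) + 1 := by
  have h1 := h.carrier_step n
  have h2 := h.carrier_nonneg (n - 1)
  rw [hn] at h1
  simp only [Fin.val_one, Nat.cast_one] at h1
  omega

theorem BBSDefined.carrier_step_zero (h : BBSDefined η) {n : ℤ} (hn : η n = 0) :
    carrier η n = max (carrier η (n - 1) - 1) 0 := by
  have h1 := h.carrier_step n
  rw [hn] at h1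
  simpa using h1

/-- If `η n = 1` the maximum stays put while `S` steps down, so the reflected path goes up. If `η n
= 0`, `S` steps up, and the maximum follows it exactly when the carrier was empty. -/
theorem bbs_eq_one_iff (h : BBSDefined η) (n : ℤ) :
    bbs η n = 1 ↔ η n = 0 ∧ 0 < carrier η (n - 1) := by
  have h1 := h.pastMax_step n
  have h2 := pathEncoding_step η n
  have h3 : pathEncoding η (n - 1) ≤ pastMax (pathEncoding η) (n - 1) :=
    (h.isGreatest_pastMax (n - 1)).2 ⟨n - 1, Set.mem_Iic.2 le_rfl, rfl⟩
  have hb : bbs η n = 1 ↔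
      pitman (pathEncoding η) n = pitman (pathEncoding η) (n - 1) - 1 := by
    simp only [bbs]
    split_ifs with hc <;> simp [hc]
  rw [hb]
  simp only [pitman, carrier]
  rcases fin_two_cases (η n) with hn | hn <;> rw [hn] at h2 ⊢ <;>
    simp only [Fin.val_one, Nat.cast_one, Fin.val_zero, Nat.cast_zero] at h2
  · simp only [true_and]
    omega
  · simp only [one_ne_zero, false_and, iff_false]
    omega

theorem bbs_eq_zero_iff (h : BBSDefined η) (n : ℤ) :
    bbs η n = 0 ↔ η n = 1 ∨ carrier η (n - 1) = 0 := by
  have h1 := bbs_eq_one_iff h n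
  have h2 := h.carrier_nonneg (n - 1)
  rcases fin_two_cases (bbs η n) with hb | hb <;> rcases fin_two_cases (η n) with hn | hn <;>
    simp [hb, hn] at h1 ⊢ <;> omega

theorem bbs_congr (h : BBSDefined η) {n k : ℤ} (hc : ∀ i ≤ n, ξ i = η (i + k)) :
    ∀ i ≤ n, bbs ξ i = bbs η (i + k) := by
  intro i hi
  have h1 := bbs_eq_one_iff h (i + k)
  have h2 := bbs_eq_one_iff (h.congr hc) i
  have h3 := h.carrier_congr (n := i - 1) (k := k) fun j hj => hc j (by omega)
  rw [h3, hc i hi] at h2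
  have e : i - 1 + k = i + k - 1 := by ring
  rw [e, ← h1] at h2
  omega

theorem isPast_bbsDefined (n : ℤ) : IsPast n {η : Config | BBSDefined η} := by
  intro f g hfg hf
  exact BBSDefined.congr (n := n) (k := 0) hf fun i hi => by simpa using (hfg i hi).symm

/-- A nonnegative process that follows the carrier dynamics and vanishes arbitrarily far to the
left is the carrier. -/
theorem carrier_eq_of_recursion {V : ℤ → ℤ} (h0 : ∀ n, 0 ≤ V n)
    (hstep : ∀ n, V n = max (V (n - 1) + 2 * ((η n : ℕ) : ℤ) - 1) 0)
    (hzero : ∀ n, ∃ m ≤ n, V m = 0) : BBSDefined η ∧ ∀ n, carrier η n = V n := by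
  -- Dropping the truncation at 0 from the recursion bounds the increments of `S`. This bounds `S`
  -- above on the left half-line, and shows that the carrier is at most 0 wherever `V` vanishes;
  -- from there the common recursion propagates equality.
  have hle : ∀ n, ∀ m ≤ n, pathEncoding η m - pathEncoding η n ≤ V n - V m := by
    intro n m hm
    induction n, hm using Int.leInduction with
    | base => simp
    | succ n hn ih =>
      have h1 := hstep (n + 1)
      have h2 := pathEncoding_step η (n + 1)
      rw [add_sub_cancel_right] at h1 h2
      omega
  have hdef : BBSDefined η := by
    refine ⟨V 0, ?_⟩
    rintro _ ⟨m, hm, rfl⟩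
    have := hle 0 m hm
    rw [pathEncoding_zero] at this
    linarith [h0 m]
  refine ⟨hdef, fun n => ?_⟩
  obtain ⟨m, hm, hVm⟩ := hzero n
  have hbase : carrier η m = V m := by
    refine le_antisymm ?_ (by rw [hVm]; exact hdef.carrier_nonneg m)
    obtain ⟨i, hi, h⟩ := (hdef.isGreatest_carrier m).1
    rw [← h]
    have := hle m i hi
    simp only
    linarith [h0 i]
  induction n, hm using Int.leInduction with
  | base => exact hbase
  | succ n hn ih =>
    have h1 := hstep (n + 1)
    have h2 := hdef.carrier_step (n + 1)
    rw [add_sub_cancel_right] at h1 h2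
    rw [h1, h2, ih]

end Carrier

/-! ### Measurability of the dynamics -/

section Measurability

theorem measurable_pathEncoding (n : ℤ) : Measurable fun η : Config => pathEncoding η n := by
  have h : ∀ i : ℤ, Measurable fun η : Config => (1 - 2 * ((η i : ℕ) : ℤ)) := fun i =>
    (measurable_from_top (f := fun a : Fin 2 => (1 - 2 * ((a : ℕ) : ℤ)))).comp
      (measurable_pi_apply i)
  unfold pathEncoding
  exact (Finset.measurable_sum _ fun i _ => h i).sub (Finset.measurable_sum _ fun i _ => h i)

theorem measurable_pastMax (n : ℤ) :
    Measurable fun η : Config => pastMax (pathEncoding η) n :=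
  Measurable.sSup (Set.to_countable _) fun i _ => measurable_pathEncoding i

theorem measurable_carrier (n : ℤ) : Measurable fun η : Config => carrier η n :=
  (measurable_pastMax n).sub (measurable_pathEncoding n)

theorem measurable_bbs : Measurable bbs := by
  have hp : ∀ n, Measurable fun η : Config => pitman (pathEncoding η) n := fun n =>
    ((measurable_const.mul (measurable_pastMax n)).sub (measurable_pathEncoding n)).sub
      (measurable_const.mul (measurable_pastMax 0))
  refine measurable_pi_iff.2 fun n => ?_
  exact Measurable.ite (measurableSet_eq_fun (hp n) ((hp (n - 1)).sub measurable_const))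
    measurable_const measurable_const

theorem measurableSet_bbsDefined : MeasurableSet {η : Config | BBSDefined η} := by
  have : {η : Config | BBSDefined η} =
      ⋃ b : ℤ, ⋂ m : Set.Iic (0 : ℤ), {η | pathEncoding η m ≤ b} := by
    ext η
    simp [BBSDefined, bddAbove_def]
  rw [this]
  exact MeasurableSet.iUnion fun b => MeasurableSet.iInter fun m =>
    measurableSet_le (measurable_pathEncoding m) measurable_const

end Measurability

/-! ### Influence from the right is cut off by empty carriers -/

section Dynamics

theorem bbs_eq_of_eq {η ξ : Config} (h : BBSDefined η) {n : ℤ} (hc : ∀ i ≤ n, η i = ξ i) :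
    ∀ i ≤ n, bbs η i = bbs ξ i := by
  intro i hi
  have := bbs_congr (k := 0) h (fun i hi => by simpa using (hc i hi).symm) i hi
  simpa using this.symm

theorem carrier_eq_of_eq {η ξ : Config} (h : BBSDefined η) {n : ℤ} (hc : ∀ i ≤ n, η i = ξ i) :
    carrier η n = carrier ξ n := by
  have := h.carrier_congr (k := 0) (fun i hi => by simpa using (hc i hi).symm)
  simpa using this.symm

theorem BBSDefined.of_eq {η ξ : Config} (h : BBSDefined η) {n : ℤ} (hc : ∀ i ≤ n, η i = ξ i) :
    BBSDefined ξ := isPast_bbsDefined n η ξ hc h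

theorem iterate_bbs_eq_of_eq {η ξ : Config} {n : ℤ} {t : ℕ}
    (h : ∀ s < t, BBSDefined (bbs^[s] η)) (hc : ∀ i ≤ n, η i = ξ i) :
    ∀ i ≤ n, bbs^[t] η i = bbs^[t] ξ i := by
  induction t with
  | zero => simpa using hc
  | succ t ih =>
    rw [Function.iterate_succ_apply', Function.iterate_succ_apply']
    exact bbs_eq_of_eq (h t (by omega)) (ih fun s hs => h s (by omega))

/-- The configurations whose current across `n` never vanishes. -/
def neverEmpty (n : ℤ) : Set Config :=
  {η | ∀ t : ℕ, BBSDefined (bbs^[t] η) ∧ 0 < carrier (bbs^[t] η) n}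

theorem measurableSet_neverEmpty (n : ℤ) : MeasurableSet (neverEmpty n) := by
  have : neverEmpty n = ⋂ t : ℕ, (bbs^[t]) ⁻¹' ({η | BBSDefined η} ∩ {η | 0 < carrier η n}) := by
    ext η; simp [neverEmpty]
  rw [this]
  exact MeasurableSet.iInter fun t => (measurable_bbs.iterate t)
    (measurableSet_bbsDefined.inter (measurableSet_lt measurable_const (measurable_carrier n)))

theorem isPast_neverEmpty (n : ℤ) : IsPast n (neverEmpty n) := by
  intro η ξ hc hη t
  have h := iterate_bbs_eq_of_eq (t := t) (fun s _ => (hη s).1) hc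
  exact ⟨(hη t).1.of_eq h, by rw [← carrier_eq_of_eq (hη t).1 h]; exact (hη t).2⟩

theorem neverEmpty_subset (n : ℤ) : neverEmpty n ⊆ bbs ⁻¹' neverEmpty n := by
  intro η hη t
  have := hη (t + 1)
  rwa [Function.iterate_succ_apply] at this

/-- The configuration without the particles to the right of `L`. -/
def truncate (L : ℤ) (η : Config) : Config := fun i => if i ≤ L then η i else 0

theorem measurable_truncate (L : ℤ) : Measurable (truncate L) := by
  refine measurable_pi_iff.2 fun i => ?_
  unfold truncate
  by_cases h : i ≤ L
  · simp only [h, if_true]; fun_prop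
  · simp only [h, if_false]; fun_prop

/-- Far in the future, a bounded window does not remember the particles initially to the right of
`L`. -/
theorem exists_forall_iterate_bbs_truncate {η : Config} (hdef : ∀ t, BBSDefined (bbs^[t] η))
    (hη : ∀ t n, bbs^[t] η ∉ neverEmpty n) (L m : ℤ) :
    ∃ t₀ : ℕ, ∀ t ≥ t₀, ∀ i ≤ m, bbs^[t] η i = bbs^[t] (truncate L η) i := by
  rcases le_total m L with hm | hm
  · refine ⟨0, fun t _ i hi => iterate_bbs_eq_of_eq (n := L) (fun s _ => hdef s) ?_ i (by omega)⟩
    intro j hj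
    simp [truncate, hj]
  have hdef' : ∀ t, BBSDefined (bbs^[t] (truncate L η)) := fun t =>
    (hdef t).of_eq (n := L) (iterate_bbs_eq_of_eq (fun s _ => hdef s) fun j hj => by
      simp [truncate, hj])
  induction m, hm using Int.leInduction with
  | base =>
    refine ⟨0, fun t _ i hi => iterate_bbs_eq_of_eq (n := L) (fun s _ => hdef s) ?_ i (by omega)⟩
    intro j hj
    simp [truncate, hj]
  | succ m hm ih =>
    obtain ⟨t₀, ht₀⟩ := ih
    -- At a time when the carrier at `m` is empty, and by `ht₀` empty for the truncated
    -- configuration too, the next step leaves site `m + 1` vacant in both. From then on they agree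
    -- up to `m + 1`, because the dynamics only looks to the left.
    obtain ⟨t₁, ht₁, hW⟩ : ∃ t₁ ≥ t₀, carrier (bbs^[t₁] η) m = 0 := by
      have := hη t₀ m
      simp only [neverEmpty, Set.mem_ofPred_eq, not_forall] at this
      obtain ⟨s, hs⟩ := this
      rw [← Function.iterate_add_apply] at hs
      refine ⟨s + t₀, by omega, ?_⟩
      have h1 := hdef (s + t₀)
      have h2 := h1.carrier_nonneg m
      have : ¬ 0 < carrier (bbs^[s + t₀] η) m := fun h => hs ⟨h1, h⟩
      omega
    refine ⟨t₁ + 1, fun t ht => ?_⟩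
    induction t, ht using Nat.le_induction with
    | base =>
      intro i hi
      rcases Int.le_iff_lt_or_eq.1 hi with hi | rfl
      · exact ht₀ _ (by omega) i (by omega)
      · rw [Function.iterate_succ_apply', Function.iterate_succ_apply',
          (bbs_eq_zero_iff (hdef t₁) (m + 1)).2, (bbs_eq_zero_iff (hdef' t₁) (m + 1)).2]
        · right
          rw [add_sub_cancel_right, ← hW]
          exact (carrier_eq_of_eq (hdef t₁) (ht₀ t₁ ht₁)).symm
        · right
          rw [add_sub_cancel_right, hW]
    | succ t ht ih =>
      intro i hi
      rw [Function.iterate_succ_apply', Function.iterate_succ_apply']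
      exact bbs_eq_of_eq (hdef t) ih i hi

end Dynamics

/-! ### Ergodicity from mixing, low density and a trivial remote past -/

section Ergodic

variable {μ : Measure Config}

theorem measureReal_inter_preimage_of_invariant (hT : MeasurePreserving bbs μ μ) {D S : Set Config}
    (hD : MeasurableSet D) (hS : MeasurableSet S) (hinv : bbs ⁻¹' D =ᵐ[μ] D) :
    μ.real (D ∩ bbs ⁻¹' S) = μ.real (D ∩ S) := by
  have h1 : (D ∩ bbs ⁻¹' S : Set Config) =ᵐ[μ] (bbs ⁻¹' (D ∩ S) : Set Config) := by
    rw [Set.preimage_inter]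
    exact hinv.symm.inter (ae_eq_refl _)
  rw [measureReal_congr h1, hT.measureReal_preimage (hD.inter hS).nullMeasurableSet]

variable [IsProbabilityMeasure μ]

/-- On an invariant event the particle density is the same at all sites. -/
theorem measureReal_inter_particle_succ (hdef : ∀ᵐ η ∂μ, BBSDefined η)
    (hT : MeasurePreserving bbs μ μ) {D : Set Config} (hD : MeasurableSet D)
    (hinv : bbs ⁻¹' D =ᵐ[μ] D) (n : ℤ) :
    μ.real (D ∩ {η | η (n + 1) = 1}) = μ.real (D ∩ {η | η n = 1}) := by
  have hm := fun (i : ℤ) (a : Fin 2) => measurableSet_coord (E := Fin 2) i a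
  -- A ball at `n` is picked up and dropped at an empty `n + 1`. Conversely, if `n` ends up empty
  -- without having held a ball, the carrier passes `n` empty and cannot drop anything at `n + 1`.
  have h1 : (D ∩ ({η | η n = 1} ∩ {η | η (n + 1) = 0}) : Set Config) =ᵐ[μ]
      (D ∩ bbs ⁻¹' ({η | η n = 0} ∩ {η | η (n + 1) = 1}) : Set Config) := by
    refine (ae_eq_refl _).inter ?_
    filter_upwards [hdef] with η h
    refine propext ?_
    change (η n = 1 ∧ η (n + 1) = 0) ↔ (bbs η n = 0 ∧ bbs η (n + 1) = 1)
    rw [bbs_eq_zero_iff h, bbs_eq_one_iff h, add_sub_cancel_right]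
    have h0 := h.carrier_nonneg (n - 1)
    constructor
    · rintro ⟨ha, hb⟩
      have := h.carrier_step_one ha
      exact ⟨Or.inl ha, hb, by omega⟩
    · rintro ⟨ha, hb, hc⟩
      refine ⟨?_, hb⟩
      rcases ha with ha | ha
      · exact ha
      · rcases fin_two_cases (η n) with h2 | h2
        · have := h.carrier_step_zero h2
          omega
        · exact h2
  have h2 := measureReal_congr h1
  rw [measureReal_inter_preimage_of_invariant hT hD ((hm _ _).inter (hm _ _)) hinv] at h2
  have h3 := measureReal_inter_add_sdiff (μ := μ) (s := D ∩ {η | η n = 1}) (hm (n + 1) 0)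
  have h4 := measureReal_inter_add_sdiff (μ := μ) (s := D ∩ {η | η (n + 1) = 1}) (hm n 0)
  have e1 : (D ∩ {η | η n = 1}) ∩ {η | η (n + 1) = 0} =
      D ∩ ({η | η n = 1} ∩ {η | η (n + 1) = 0}) := Set.inter_assoc _ _ _
  have e2 : (D ∩ {η | η (n + 1) = 1}) ∩ {η | η n = 0} =
      D ∩ ({η | η n = 0} ∩ {η | η (n + 1) = 1}) := by
    rw [Set.inter_assoc, Set.inter_comm {η : Config | η (n + 1) = 1}]
  -- The pattern 11 is common to both sites, so equality of the probabilities of 10 and 01 suffices.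
  have e3 : (D ∩ {η : Config | η n = 1}) \ {η | η (n + 1) = 0} =
      (D ∩ {η | η (n + 1) = 1}) \ {η | η n = 0} := by
    ext η
    simp only [Set.mem_sdiff, Set.mem_inter_iff, Set.mem_ofPred_eq]
    rcases fin_two_cases (η n) with h | h <;> rcases fin_two_cases (η (n + 1)) with h' | h' <;>
      simp [h, h']
  rw [e1, e3] at h3
  rw [e2] at h4
  linarith

/-- In a subcritical mixing environment every current vanishes at some time. -/
theorem measureReal_neverEmpty (hdef : ∀ᵐ η ∂μ, BBSDefined η) (hT : MeasurePreserving bbs μ μ)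
    {ρ : ℝ} (hρ : ρ < 1 / 2)
    (hmix : ∀ (n : ℤ) (B : Set Config), MeasurableSet B → IsPast n B →
      Tendsto (fun m : ℕ => μ.real (B ∩ {η | η (n + m) = 1})) atTop (𝓝 (μ.real B * ρ))) (n : ℤ) :
    μ.real (neverEmpty n) = 0 := by
  have hD := measurableSet_neverEmpty n
  have hm := fun (i : ℤ) (a : Fin 2) => measurableSet_coord (E := Fin 2) i a
  -- The event is contained in its preimage, which has the same finite measure.
  have hinv : bbs ⁻¹' neverEmpty n =ᵐ[μ] neverEmpty n :=
    (ae_eq_of_subset_of_measure_ge (neverEmpty_subset n)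
      (hT.measure_preimage hD.nullMeasurableSet).le hD.nullMeasurableSet
      (measure_ne_top _ _)).symm
  have hconst : ∀ m : ℕ, μ.real (neverEmpty n ∩ {η | η (n + m) = 1}) =
      μ.real (neverEmpty n ∩ {η | η (n + 1) = 1}) := by
    intro m
    have h0 : ∀ m : ℕ, μ.real (neverEmpty n ∩ {η | η (n + m) = 1}) =
        μ.real (neverEmpty n ∩ {η | η n = 1}) := by
      intro m
      induction m with
      | zero => simp
      | succ m ih =>
        have := measureReal_inter_particle_succ hdef hT hD hinv (n + m)
        rw [ih] at this
        simpa [add_assoc] using this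
    rw [h0, ← h0 1]
    simp
  have hlim := hmix n _ hD (isPast_neverEmpty n)
  simp only [hconst] at hlim
  have hval := tendsto_nhds_unique tendsto_const_nhds hlim
  -- With a nonempty carrier at `n`, site `n + 1` is filled exactly when it was empty, so half of
  -- the mass of the event has a particle there.
  have hflip : neverEmpty n ∩ bbs ⁻¹' {η | η (n + 1) = 1} = neverEmpty n ∩ {η | η (n + 1) = 0} := by
    ext η
    simp only [Set.mem_inter_iff, Set.mem_preimage, Set.mem_ofPred_eq]
    refine and_congr_right fun hη => ?_
    have h0 := hη 0
    simp only [Function.iterate_zero, id_eq] at h0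
    rw [bbs_eq_one_iff h0.1, add_sub_cancel_right]
    exact ⟨fun h => h.1, fun h => ⟨h, h0.2⟩⟩
  have h1 := measureReal_inter_preimage_of_invariant hT hD (hm (n + 1) 1) hinv
  rw [hflip] at h1
  have h2 := measureReal_inter_add_sdiff (μ := μ) (s := neverEmpty n) (hm (n + 1) 0)
  have e : neverEmpty n \ {η : Config | η (n + 1) = 0} =
      neverEmpty n ∩ {η | η (n + 1) = 1} := by
    ext η
    simp only [Set.mem_sdiff, Set.mem_inter_iff, Set.mem_ofPred_eq]
    rcases fin_two_cases (η (n + 1)) with h' | h' <;> simp [h']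
  rw [e, h1] at h2
  have : μ.real (neverEmpty n) * (1 - 2 * ρ) = 0 := by linarith
  rcases mul_eq_zero.1 this with h | h
  · exact h
  · linarith

/-- The hypothesis `htail` reduces the claim to approximating an invariant event by events of the
past of an arbitrary `L`. -/
theorem ergodic_bbs (hdef : ∀ᵐ η ∂μ, BBSDefined η) (hT : MeasurePreserving bbs μ μ)
    {ρ : ℝ} (hρ : ρ < 1 / 2)
    (hmix : ∀ (n : ℤ) (B : Set Config), MeasurableSet B → IsPast n B →
      Tendsto (fun m : ℕ => μ.real (B ∩ {η | η (n + m) = 1})) atTop (𝓝 (μ.real B * ρ)))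
    (htail : ∀ B : Set Config, MeasurableSet B →
      (∀ (n : ℤ) (ε : ℝ), 0 < ε → ∃ B' : Set Config, MeasurableSet B' ∧ IsPast n B' ∧
        μ.real (symmDiff B B') ≤ ε) → μ.real B = 0 ∨ μ.real B = 1) :
    Ergodic bbs μ := by
  refine ⟨hT, ⟨fun A hA hinv => ?_⟩⟩
  have hdef' : ∀ᵐ η ∂μ, ∀ t, BBSDefined (bbs^[t] η) :=
    ae_all_iff.2 fun t => (hT.iterate t).quasiMeasurePreserving.ae hdef
  have hnev : ∀ᵐ η ∂μ, ∀ t n, bbs^[t] η ∉ neverEmpty n := by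
    refine ae_all_iff.2 fun t => (hT.iterate t).quasiMeasurePreserving.ae
      (p := fun η => ∀ n, η ∉ neverEmpty n) (ae_all_iff.2 fun n => ?_)
    have := measureReal_neverEmpty hdef hT hρ hmix n
    rw [measureReal_eq_zero_iff] at this
    exact measure_eq_zero_iff_ae_notMem.1 this
  have hAt : ∀ t : ℕ, bbs^[t] ⁻¹' A = A := by
    intro t
    induction t with
    | zero => rfl
    | succ t ih => rw [Function.iterate_succ, Set.preimage_comp, ih, hinv]
  have h01 : μ.real A = 0 ∨ μ.real A = 1 := by
    refine htail A hA fun L ε hε => ?_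
    obtain ⟨C, hC, hCA⟩ := exists_measure_symmDiff_lt_of_generateFrom_isSetRing (μ := μ)
      (C := measurableCylinders fun _ : ℤ => Fin 2) isSetRing_measurableCylinders
      ⟨{Set.univ}, Set.countable_singleton _, by
        simpa using univ_mem_measurableCylinders (fun _ : ℤ => Fin 2), by simp⟩
      (generateFrom_measurableCylinders (α := fun _ : ℤ => Fin 2)).symm hA
      -- One half of the error comes from replacing `A` by a cylinder `C`: since `A` is invariant
      -- and the law is preserved, the preimage of `C` at time `t` is as close to `A` as `C` is. The
      -- other half comes from truncating the initial configuration at `L`, for `t` large.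
      (ε := ENNReal.ofReal (ε / 2)) (by simpa using hε)
    have hCm : MeasurableSet C := .of_mem_measurableCylinders hC
    obtain ⟨I, S, hS, rfl⟩ := (mem_measurableCylinders _).1 hC
    obtain ⟨m, hm⟩ : ∃ m : ℤ, ∀ i ∈ I, i ≤ m := I.exists_le
    have hlim : Tendsto (fun t : ℕ => μ (symmDiff (bbs^[t] ⁻¹' cylinder I S)
        ((fun η => bbs^[t] (truncate L η)) ⁻¹' cylinder I S))) atTop (𝓝 (μ ∅)) := by
      refine tendsto_measure_of_ae_tendsto_indicator_of_isFiniteMeasure _ MeasurableSet.empty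
        (fun t => ?_) ?_
      · exact (measurable_bbs.iterate t hCm).symmDiff
          (((measurable_bbs.iterate t).comp (measurable_truncate L)) hCm)
      · filter_upwards [hdef', hnev] with η h1 h2
        obtain ⟨t₀, ht₀⟩ := exists_forall_iterate_bbs_truncate h1 h2 L m
        filter_upwards [eventually_ge_atTop t₀] with t ht
        have : I.restrict (bbs^[t] η) = I.restrict (bbs^[t] (truncate L η)) := by
          funext i
          exact ht₀ t ht i (hm i i.2)
        simp only [Set.mem_symmDiff, Set.mem_preimage, mem_cylinder, this, Set.mem_empty_iff_false]
        tauto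
    rw [measure_empty] at hlim
    obtain ⟨t, ht⟩ := (hlim.eventually (gt_mem_nhds
      (show (0 : ENNReal) < ENNReal.ofReal (ε / 2) by simpa using hε))).exists
    refine ⟨(fun η => bbs^[t] (truncate L η)) ⁻¹' cylinder I S,
      ((measurable_bbs.iterate t).comp (measurable_truncate L)) hCm, ?_, ?_⟩
    · intro f g hfg hf
      have : truncate L f = truncate L g := by
        funext i
        simp only [truncate]
        split_ifs with hi
        · exact hfg i hi
        · rfl
      simpa [this] using hf
    · have h1 : μ (symmDiff A (bbs^[t] ⁻¹' cylinder I S)) < ENNReal.ofReal (ε / 2) := by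
        conv_lhs => rw [← hAt t, ← Set.preimage_symmDiff]
        rw [(hT.iterate t).measure_preimage (hA.symmDiff hCm).nullMeasurableSet, symmDiff_comm]
        exact hCA
      have h2 := (measure_symmDiff_le A (bbs^[t] ⁻¹' cylinder I S)
        ((fun η => bbs^[t] (truncate L η)) ⁻¹' cylinder I S) (μ := μ)).trans
          (add_le_add h1.le ht.le)
      rw [← ENNReal.ofReal_add (by positivity) (by positivity), add_halves] at h2
      exact ENNReal.toReal_le_of_le_ofReal hε.le h2
  rw [eventuallyConst_set']
  rcases h01 with h | h
  · left
    rw [measureReal_eq_zero_iff] at h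
    exact ae_eq_empty.2 h
  · right
    rw [ae_eq_univ, ← measureReal_eq_zero_iff, probReal_compl_eq_one_sub hA, h, sub_self]

end Ergodic

/-! ### Configurations driven by a finite Markov chain -/

section Driven

variable {E : Type*}

/-- The configuration read off from the transitions of a path. -/
def ofTransitions (f : E → E → Fin 2) (x : ℤ → E) : Config := fun n => f (x (n - 1)) (x n)

theorem measurable_ofTransitions [Fintype E] [MeasurableSpace E] [MeasurableSingletonClass E]
    (f : E → E → Fin 2) : Measurable (ofTransitions f) := by
  refine measurable_pi_iff.2 fun n => ?_
  have h : Measurable fun x : ℤ → E => (x (n - 1), x n) := by fun_prop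
  exact (measurable_of_finite (fun p : E × E => f p.1 p.2)).comp h

theorem isPast_ofTransitions (f : E → E → Fin 2) {n : ℤ} {B : Set Config} (hB : IsPast n B) :
    IsPast n (ofTransitions f ⁻¹' B) := by
  intro x y hxy hx
  refine hB _ _ (fun i hi => ?_) hx
  simp only [ofTransitions]
  rw [hxy _ (by omega), hxy _ hi]

end Driven

section Driven

variable {Ω E : Type*} [MeasurableSpace Ω] [Fintype E] [DecidableEq E] [MeasurableSpace E]
  [MeasurableSingletonClass E] {P : Measure Ω} [IsProbabilityMeasure P] {X : Ω → ℤ → E}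
  {Q : Matrix E E ℝ}

theorem IsStationaryMarkovChain.past_transition (hX : IsStationaryMarkovChain P X Q)
    (hQ : ∀ x y, 0 ≤ Q x y) {n : ℤ} {B : Set (ℤ → E)} (hB : MeasurableSet B) (hBn : IsPast n B)
    (f : E → E → Fin 2) :
    P.real {ω | X ω ∈ B ∧ ofTransitions f (X ω) (n + 1) = 1} =
      ∑ x, ∑ y, if f x y = 1 then P.real {ω | X ω ∈ B ∧ X ω n = x} * Q x y else 0 := by
  rw [← sum_measureReal_coord (P := P) hX.measurable n]
  refine Finset.sum_congr rfl fun x _ => ?_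
  rw [← sum_measureReal_coord (P := P) hX.measurable (n + 1)]
  refine Finset.sum_congr rfl fun y _ => ?_
  split_ifs with hf
  · rw [← hX.past hQ hB hBn]
    congr 1
    ext ω
    simp only [Set.mem_ofPred_eq, ofTransitions, add_sub_cancel_right]
    constructor
    · rintro ⟨⟨⟨h1, -⟩, h2⟩, h3⟩
      exact ⟨h1, h2, h3⟩
    · rintro ⟨h1, rfl, rfl⟩
      exact ⟨⟨⟨h1, hf⟩, rfl⟩, rfl⟩
  · have : {ω | ω ∈ {ω | ω ∈ {ω | X ω ∈ B ∧ ofTransitions f (X ω) (n + 1) = 1} ∧ X ω n = x} ∧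
        X ω (n + 1) = y} = ∅ := by
      ext ω
      simp only [Set.mem_ofPred_eq, ofTransitions, add_sub_cancel_right, Set.mem_empty_iff_false,
        iff_false]
      rintro ⟨⟨⟨-, h1⟩, rfl⟩, rfl⟩
      exact hf h1
    rw [this, measureReal_empty]

/-- The particle at a remote site is asymptotically independent of the past. -/
theorem IsStationaryMarkovChain.tendsto_particle (hX : IsStationaryMarkovChain P X Q)
    (hQ : Q ∈ Matrix.rowStochastic ℝ E) (hD : IsDoeblin Q) (f : E → E → Fin 2) (n : ℤ)
    {B : Set Config} (hB : MeasurableSet B) (hBn : IsPast n B) :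
    Tendsto (fun m : ℕ => (P.map fun ω => ofTransitions f (X ω)).real
      (B ∩ {η | η (n + m) = 1})) atTop
      (𝓝 ((P.map fun ω => ofTransitions f (X ω)).real B *
        (P.map fun ω => ofTransitions f (X ω)).real {η | η 0 = 1})) := by
  have hQ0 : ∀ x y, 0 ≤ Q x y := (Matrix.mem_rowStochastic_iff_sum.1 hQ).1
  have hf : Measurable fun ω => ofTransitions f (X ω) :=
    (measurable_ofTransitions f).comp hX.measurable
  have hm : ∀ i : ℤ, MeasurableSet {η : Config | η i = 1} := fun i => measurableSet_coord i 1
  have hB' := measurable_ofTransitions f hB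
  have hBn' := isPast_ofTransitions f hBn
  have hρ : (P.map fun ω => ofTransitions f (X ω)).real {η | η 0 = 1} =
      ∑ x, ∑ y, if f x y = 1 then P.real {ω | X ω 0 = x} * Q x y else 0 := by
    have h := hX.past_transition hQ0 (n := -1) (B := Set.univ) MeasurableSet.univ
      (fun _ _ _ _ => trivial) f
    simp only [Set.mem_univ, true_and, hX.coord (-1), neg_add_cancel] at h
    rw [← h, map_measureReal_apply hf (hm 0)]
    rfl
  -- The index moves by one because the particle at `n + m + 1` is read off the transition that
  -- leaves the chain's state at time `n + m`.
  rw [hρ, map_measureReal_apply hf hB, ← tendsto_add_atTop_iff_nat 1, Finset.mul_sum]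
  have hval : ∀ m : ℕ, (P.map fun ω => ofTransitions f (X ω)).real
      (B ∩ {η | η (n + (m + 1 : ℕ)) = 1}) = ∑ x, ∑ y, if f x y = 1 then
        P.real {ω | X ω ∈ ofTransitions f ⁻¹' B ∧ X ω (n + m) = x} * Q x y else 0 := by
    intro m
    rw [← hX.past_transition hQ0 hB' (hBn'.mono (by omega)) f,
      map_measureReal_apply hf (hB.inter (hm _))]
    congr 1
    ext ω
    simp [add_assoc]
  simp only [hval]
  refine tendsto_finsetSum _ fun x _ => ?_
  rw [Finset.mul_sum]
  refine tendsto_finsetSum _ fun y _ => ?_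
  split_ifs with hxy
  · rw [← mul_assoc]
    exact (hX.tendsto_past hQ hD hB' hBn' x).mul_const _
  · simp

/-- Mixing and tail triviality pass from the chain to the configuration, because the configuration
up to `n` is a function of the chain up to `n`. -/
theorem IsStationaryMarkovChain.ergodic_bbs (hX : IsStationaryMarkovChain P X Q)
    (hQ : Q ∈ Matrix.rowStochastic ℝ E) (hD : IsDoeblin Q) (f : E → E → Fin 2)
    (hdef : ∀ᵐ η ∂(P.map fun ω => ofTransitions f (X ω)), BBSDefined η)
    (hT : MeasurePreserving bbs (P.map fun ω => ofTransitions f (X ω))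
      (P.map fun ω => ofTransitions f (X ω)))
    (hρ : (P.map fun ω => ofTransitions f (X ω)).real {η | η 0 = 1} < 1 / 2) :
    Ergodic bbs (P.map fun ω => ofTransitions f (X ω)) := by
  have hf : Measurable fun ω => ofTransitions f (X ω) :=
    (measurable_ofTransitions f).comp hX.measurable
  have : IsProbabilityMeasure (P.map fun ω => ofTransitions f (X ω)) :=
    Measure.isProbabilityMeasure_map hf.aemeasurable
  refine _root_.ergodic_bbs hdef hT hρ
    (fun n B hB hBn => hX.tendsto_particle hQ hD f n hB hBn) ?_
  intro B hB happ
  rw [map_measureReal_apply hf hB]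
  refine hX.measureReal_eq_zero_or_one hQ hD (measurable_ofTransitions f hB) fun n ε hε => ?_
  obtain ⟨B', hB', hB'n, hle⟩ := happ n ε hε
  rw [map_measureReal_apply hf (hB.symmDiff hB')] at hle
  exact ⟨_, measurable_ofTransitions f hB', isPast_ofTransitions f hB'n, hle⟩

end Driven

/-! ### Time reversal and invariance -/

section Reversal

theorem measureReal_window_eq_prod {Ω F : Type*} [MeasurableSpace Ω] {P : Measure Ω}
    {Y : Ω → ℤ → F} {ν : F → ℝ} {R : F → F → ℝ}
    (hν : ∀ n e, P.real {ω | Y ω n = e} = ν e)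
    (hY : ∀ (n : ℤ) (k : ℕ) (x : ℕ → F), P.real {ω | ∀ i ≤ k + 1, Y ω (n + (i : ℤ)) = x i} =
      P.real {ω | ∀ i ≤ k, Y ω (n + (i : ℤ)) = x i} * R (x k) (x (k + 1)))
    (n : ℤ) (k : ℕ) (x : ℕ → F) :
    P.real {ω | ∀ i ≤ k, Y ω (n + (i : ℤ)) = x i} =
      ν (x 0) * ∏ i ∈ Finset.range k, R (x i) (x (i + 1)) := by
  induction k with
  | zero => simp [hν]
  | succ k ih => rw [hY, ih, Finset.prod_range_succ, mul_assoc]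

variable {Ω F : Type*} [MeasurableSpace Ω] [Countable F] [MeasurableSpace F]
  [MeasurableSingletonClass F] {P : Measure Ω} [IsProbabilityMeasure P]

/-- Time reversal of a Markov process that satisfies the detailed balance equations up to an
involution of the state space. -/
theorem map_reverse_eq {Y : Ω → ℤ → F} (hYm : Measurable Y) {ν : F → ℝ} {R : F → F → ℝ}
    (hν : ∀ n e, P.real {ω | Y ω n = e} = ν e)
    (hY : ∀ (n : ℤ) (k : ℕ) (x : ℕ → F), P.real {ω | ∀ i ≤ k + 1, Y ω (n + (i : ℤ)) = x i} =
      P.real {ω | ∀ i ≤ k, Y ω (n + (i : ℤ)) = x i} * R (x k) (x (k + 1)))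
    (ι : F → F) (hι : Function.Involutive ι) (hινn : ∀ e, ν (ι e) = ν e)
    (hbal : ∀ e e', ν e * R e e' = ν (ι e') * R (ι e') (ι e)) (c : ℤ) :
    P.map (fun ω n => ι (Y ω (c - n))) = P.map Y := by
  have : Nonempty F := by
    obtain ⟨ω⟩ := nonempty_of_isProbabilityMeasure P
    exact ⟨Y ω 0⟩
  have hιm : Measurable ι := measurable_of_countable ι
  have hm : Measurable fun ω n => ι (Y ω (c - n)) := by fun_prop
  refine ext_of_int_windows fun n k x => ?_
  have hw := measurableSet_window n k x
  rw [← measureReal_eq_measureReal_iff, map_measureReal_apply hm hw, map_measureReal_apply hYm hw]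
  have e1 : (fun ω n => ι (Y ω (c - n))) ⁻¹' {f | ∀ i ≤ k, f (n + (i : ℤ)) = x i} =
      {ω | ∀ i ≤ k, Y ω (c - n - k + (i : ℤ)) = (fun j => ι (x (k - j))) i} := by
    ext ω
    simp only [Set.mem_preimage, Set.mem_ofPred_eq]
    constructor
    · intro h i hi
      rw [← h (k - i) (by omega), hι]
      congr 1
      omega
    · intro h i hi
      have := h (k - i) (by omega)
      rw [show k - (k - i) = i by omega] at this
      rw [← hι (x i), ← this]
      congr 2
      omega
  have e2 : Y ⁻¹' {f | ∀ i ≤ k, f (n + (i : ℤ)) = x i} = {ω | ∀ i ≤ k, Y ω (n + (i : ℤ)) = x i} :=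
    rfl
  rw [e1, e2, measureReal_window_eq_prod hν hY, measureReal_window_eq_prod hν hY]
  -- Detailed balance moves `ν` from the start of the path to its end, one factor at a time,
  -- reversing each factor as it passes.
  have key : ∀ k : ℕ, ν (x 0) * ∏ i ∈ Finset.range k, R (x i) (x (i + 1)) =
      ν (ι (x k)) * ∏ i ∈ Finset.range k, R (ι (x (i + 1))) (ι (x i)) := by
    intro k
    induction k with
    | zero => simp [hινn]
    | succ k ih =>
      rw [Finset.prod_range_succ, Finset.prod_range_succ, ← mul_assoc, ih, hινn, mul_right_comm,
        hbal]
      ring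
  rw [key, ← Finset.prod_range_reflect]
  simp only [Nat.sub_zero]
  congr 1
  refine Finset.prod_congr rfl fun i hi => ?_
  have := Finset.mem_range.1 hi
  congr 3 <;> omega

/-- The configuration whose particles are the up-steps of a path. -/
def upSteps (w : ℤ → ℤ) : Config := fun n => if w n = w (n - 1) + 1 then 1 else 0

theorem measurable_upSteps : Measurable upSteps := by
  refine measurable_pi_iff.2 fun n => ?_
  exact Measurable.ite (measurableSet_eq_fun (by fun_prop) (by fun_prop)) measurable_const
    measurable_const

theorem upSteps_carrier {η : Config} (h : BBSDefined η) : upSteps (carrier η) = η := by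
  funext n
  simp only [upSteps]
  have h0 := h.carrier_nonneg (n - 1)
  rcases fin_two_cases (η n) with hn | hn
  · have := h.carrier_step_zero hn
    rw [hn, if_neg (by omega)]
  · rw [hn, if_pos (h.carrier_step_one hn)]

/-- A down-step of the carrier is a particle of `bbs η`, and reflection turns it into an up-step.
The bond between `n - 1` and `n` is reflected to the one between `-n` and `1 - n`, which belongs to
site `1 - n`. -/
theorem upSteps_carrier_neg {η : Config} (h : BBSDefined η) :
    upSteps (fun n => carrier η (-n)) = fun n => bbs η (1 - n) := by
  funext n
  have h1 := bbs_eq_one_iff h (1 - n)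
  have h0 := h.carrier_nonneg (1 - n - 1)
  simp only [upSteps]
  have e1 : -n = 1 - n - 1 := by ring
  have e2 : -(n - 1) = 1 - n := by ring
  simp only [e1, e2]
  rcases fin_two_cases (η (1 - n)) with hn | hn
  · have h2 := h.carrier_step_zero hn
    simp only [hn, true_and] at h1
    split_ifs with hc
    · exact (h1.2 (by omega)).symm
    · have : ¬ bbs η (1 - n) = 1 := fun hb => by have := h1.1 hb; omega
      exact ((fin_two_cases _).resolve_right this).symm
  · have h2 := h.carrier_step_one hn
    rw [if_neg (by omega), (bbs_eq_zero_iff h _).2 (Or.inl hn)]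

/-- A law on configurations that is invariant under reversal, with a carrier whose law is also
invariant under reversal, is invariant under the box-ball dynamics. -/
theorem measurePreserving_bbs {μ : Measure Config} (hdef : ∀ᵐ η ∂μ, BBSDefined η)
    (hrev : μ.map (fun η n => η (1 - n)) = μ)
    (hW : μ.map (fun η n => carrier η (-n)) = μ.map carrier) : MeasurePreserving bbs μ μ := by
  refine ⟨measurable_bbs, ?_⟩
  have hc : Measurable carrier := measurable_pi_iff.2 measurable_carrier
  have hc' : Measurable fun (η : Config) (n : ℤ) => carrier η (-n) :=
    measurable_pi_iff.2 fun n => measurable_carrier (-n)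
  have hr : Measurable fun (η : Config) (n : ℤ) => η (1 - n) := by fun_prop
  -- Taking up-steps of both carriers shows that the reversal of `bbs η` has the law of `η`;
  -- reversing once more and using `hrev` concludes.
  have h1 := congrArg (fun ν => ν.map upSteps) hW
  rw [Measure.map_map measurable_upSteps hc', Measure.map_map measurable_upSteps hc] at h1
  have h2 : μ.map (upSteps ∘ carrier) = μ := by
    conv_rhs => rw [← Measure.map_id (μ := μ)]
    exact Measure.map_congr (hdef.mono fun η h => upSteps_carrier h)
  have h3 : μ.map (upSteps ∘ fun (η : Config) (n : ℤ) => carrier η (-n)) =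
      (μ.map bbs).map (fun η n => η (1 - n)) := by
    rw [Measure.map_map hr measurable_bbs]
    exact Measure.map_congr (hdef.mono fun η h => upSteps_carrier_neg h)
  rw [h2, h3] at h1
  have h4 := congrArg (fun ν => ν.map fun (η : Config) (n : ℤ) => η (1 - n)) h1
  simp only [hrev] at h4
  rw [Measure.map_map hr hr] at h4
  have h5 : (fun (η : Config) (n : ℤ) => η (1 - n)) ∘ (fun (η : Config) (n : ℤ) => η (1 - n)) =
      id := by
    funext η n
    simp
  rwa [h5, Measure.map_id] at h4

/-- Two equally distributed integers at distance at most one. -/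
theorem measureReal_up_eq_down {U V : Ω → ℤ} (hU : Measurable U) (hV : Measurable V)
    (hUV : ∀ᵐ ω ∂P, |U ω - V ω| ≤ 1) (hlaw : ∀ w, P.real {ω | U ω ≤ w} = P.real {ω | V ω ≤ w})
    (w : ℤ) : P.real {ω | U ω = w ∧ V ω = w + 1} = P.real {ω | U ω = w + 1 ∧ V ω = w} := by
  have h1 := measureReal_inter_add_sdiff (μ := P) (s := {ω | U ω ≤ w})
    (measurableSet_le hV (measurable_const (a := w)))
  have h2 := measureReal_inter_add_sdiff (μ := P) (s := {ω | V ω ≤ w})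
    (measurableSet_le hU (measurable_const (a := w)))
  rw [Set.inter_comm] at h2
  -- As the two values differ by at most one, these are the crossings of level `w` in either
  -- direction, and equality of the laws balances them.
  have e1 : P.real {ω | U ω = w ∧ V ω = w + 1} = P.real ({ω | U ω ≤ w} \ {ω | V ω ≤ w}) := by
    refine measureReal_congr (hUV.mono fun ω h => propext ?_)
    change (U ω = w ∧ V ω = w + 1) ↔ (U ω ≤ w ∧ ¬ V ω ≤ w)
    rw [abs_le] at h
    omega
  have e2 : P.real {ω | U ω = w + 1 ∧ V ω = w} = P.real ({ω | V ω ≤ w} \ {ω | U ω ≤ w}) := by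
    refine measureReal_congr (hUV.mono fun ω h => propext ?_)
    change (U ω = w + 1 ∧ V ω = w) ↔ (V ω ≤ w ∧ ¬ U ω ≤ w)
    rw [abs_le] at h
    omega
  rw [e1, e2]
  have := hlaw w
  linarith

end Reversal

/-! ### Subcritical environments have a finite past maximum -/

section Subcritical

/-- The carrier started empty, `N` steps before. -/
def carrierFrom : ℕ → ℤ → Config → ℤ
  | 0, _, _ => 0
  | N + 1, n, η => max (carrierFrom N (n - 1) η + 2 * ((η n : ℕ) : ℤ) - 1) 0

theorem carrierFrom_nonneg (N : ℕ) (n : ℤ) (η : Config) : 0 ≤ carrierFrom N n η := by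
  cases N with
  | zero => exact le_rfl
  | succ N => exact le_max_right _ _

theorem carrierFrom_le (N : ℕ) (n : ℤ) (η : Config) : carrierFrom N n η ≤ N := by
  induction N generalizing n with
  | zero => exact le_rfl
  | succ N ih =>
    have := ih (n - 1)
    simp only [carrierFrom]
    rcases fin_two_cases (η n) with h | h <;> rw [h] <;>
      simp only [Fin.val_one, Nat.cast_one, Fin.val_zero, Nat.cast_zero, Nat.cast_add] <;> omega

theorem carrierFrom_le_succ (N : ℕ) (n : ℤ) (η : Config) :
    carrierFrom N n η ≤ carrierFrom (N + 1) n η := by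
  induction N generalizing n with
  | zero => exact carrierFrom_nonneg _ _ _
  | succ N ih =>
    have := ih (n - 1)
    rw [carrierFrom, carrierFrom]
    omega

theorem carrierFrom_shift (N : ℕ) (n : ℤ) (η : Config) :
    carrierFrom N n (fun i => η (i + 1)) = carrierFrom N (n + 1) η := by
  induction N generalizing n with
  | zero => rfl
  | succ N ih =>
    rw [carrierFrom, carrierFrom, ih]
    simp

/-- Without truncation at 0 the recursion would reproduce minus the increment of `S`, and truncation
only increases it. -/
theorem sub_le_carrierFrom (N : ℕ) (n : ℤ) (η : Config) :
    pathEncoding η (n - N) - pathEncoding η n ≤ carrierFrom N n η := by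
  induction N generalizing n with
  | zero => simp [carrierFrom]
  | succ N ih =>
    have h1 := ih (n - 1)
    have h2 := pathEncoding_step η n
    rw [carrierFrom]
    have e : n - ((N + 1 : ℕ) : ℤ) = n - 1 - N := by push_cast; ring
    rw [e]
    omega

theorem measurable_carrierFrom (N : ℕ) (n : ℤ) : Measurable (carrierFrom N n) := by
  induction N generalizing n with
  | zero => exact measurable_const
  | succ N ih =>
    have h : Measurable fun η : Config => ((η n : ℕ) : ℤ) :=
      (measurable_from_top (f := fun a : Fin 2 => ((a : ℕ) : ℤ))).comp (measurable_pi_apply n)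
    exact (((ih (n - 1)).add (measurable_const.mul h)).sub measurable_const).max measurable_const

theorem bbsDefined_of_carrierFrom_eq_zero {η : Config} (h : ∀ N, carrierFrom N 0 η = 0) :
    BBSDefined η := by
  refine ⟨0, ?_⟩
  rintro _ ⟨m, hm, rfl⟩
  have h1 := sub_le_carrierFrom (-m).toNat 0 η
  have hm' : m ≤ 0 := hm
  rw [h, pathEncoding_zero, show (0 : ℤ) - ((-m).toNat : ℤ) = m by omega] at h1
  linarith

theorem bbsDefined_shift_iff (η : Config) (k : ℤ) :
    BBSDefined (fun i => η (i + k)) ↔ BBSDefined η := by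
  constructor
  · intro h
    exact h.congr (n := 0) (k := -k) fun i _ => by simp
  · intro h
    exact h.congr (n := 0) (k := k) fun i _ => rfl

theorem carrier_shift {η : Config} (h : BBSDefined η) (k n : ℤ) :
    carrier (fun i => η (i + k)) n = carrier η (n + k) :=
  h.carrier_congr fun _ _ => rfl

/-- In a stationary, mixing and subcritical environment the dynamics is well defined. -/
theorem ae_bbsDefined {μ : Measure Config} [IsProbabilityMeasure μ]
    (hshift : μ.map (fun η n => η (n + 1)) = μ) {ρ : ℝ} (hρ : ρ < 1 / 2)
    (hmix : ∀ (n : ℤ) (B : Set Config), MeasurableSet B → IsPast n B →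
      Tendsto (fun m : ℕ => μ.real (B ∩ {η | η (n + m) = 1})) atTop (𝓝 (μ.real B * ρ))) :
    ∀ᵐ η ∂μ, BBSDefined η := by
  set G : Set Config := {η | BBSDefined η}ᶜ with hG
  have hGm : MeasurableSet G := measurableSet_bbsDefined.compl
  have hs : Measurable fun (η : Config) (n : ℤ) => η (n + 1) := by fun_prop
  have hm : ∀ i : ℤ, MeasurableSet {η : Config | η i = 1} := fun i => measurableSet_coord i 1
  have hGs : ∀ η : Config, (fun n => η (n + 1)) ∈ G ↔ η ∈ G := fun η =>
    not_congr (bbsDefined_shift_iff η 1)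
  have hGpast : IsPast 0 G := by
    intro f g hfg hf hg
    exact hf (isPast_bbsDefined 0 g f (fun i hi => (hfg i hi).symm) hg)
  have hstep : ∀ n : ℤ, μ.real (G ∩ {η | η (n + 1) = 1}) = μ.real (G ∩ {η | η n = 1}) := by
    intro n
    have h := congrArg (fun ν => ν.real (G ∩ {η | η n = 1})) hshift
    rw [map_measureReal_apply hs (hGm.inter (hm n))] at h
    rw [← h]
    congr 1
    ext η
    exact and_congr_left fun _ => (hGs η).symm
  have hconst : ∀ m : ℕ, μ.real (G ∩ {η | η (0 + (m : ℤ)) = 1}) = μ.real (G ∩ {η | η 1 = 1}) := by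
    have h0 : ∀ m : ℕ, μ.real (G ∩ {η | η (0 + (m : ℤ)) = 1}) = μ.real (G ∩ {η | η 0 = 1}) := by
      intro m
      induction m with
      | zero => simp
      | succ m ih =>
        have := hstep (0 + m)
        rw [ih] at this
        simpa [add_assoc] using this
    intro m
    rw [h0, ← h0 1]
    simp
  have hlim := hmix 0 G hGm hGpast
  simp only [hconst] at hlim
  have hval := tendsto_nhds_unique tendsto_const_nhds hlim
  have hint : ∀ N n, Integrable (fun η => G.indicator (fun η => (carrierFrom N n η : ℝ)) η) μ := by
    intro N n
    have hmeas : Measurable fun η => (carrierFrom N n η : ℝ) :=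
      measurable_from_top.comp (measurable_carrierFrom N n)
    refine Integrable.indicator ?_ hGm
    refine Integrable.of_bound hmeas.aestronglyMeasurable (N : ℝ) (ae_of_all _ fun η => ?_)
    have h1 := carrierFrom_nonneg N n η
    have h2 := carrierFrom_le N n η
    rw [Real.norm_of_nonneg (by exact_mod_cast h1)]
    exact_mod_cast h2
  have hinv : ∀ N, ∫ η, G.indicator (fun η => (carrierFrom N 1 η : ℝ)) η ∂μ =
      ∫ η, G.indicator (fun η => (carrierFrom N 0 η : ℝ)) η ∂μ := by
    intro N
    conv_rhs => rw [← hshift]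
    rw [integral_map hs.aemeasurable (by rw [hshift]; exact (hint N 0).aestronglyMeasurable)]
    refine integral_congr_ae (ae_of_all _ fun η => ?_)
    by_cases hη : η ∈ G
    · simp only [Set.indicator_of_mem hη, Set.indicator_of_mem ((hGs η).2 hη), carrierFrom_shift,
        zero_add]
    · simp only [Set.indicator_of_notMem hη, Set.indicator_of_notMem (mt (hGs η).1 hη)]
  -- In one step the carrier changes by twice the particle minus one, except that nothing is lost
  -- when it is empty. By stationarity and monotonicity in `N` its mean over `G` does not decrease,
  -- so the loss, at least `μ G` minus the mass where the carrier is empty, is paid for by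
  -- particles.
  have hineq : ∀ N, μ.real G ≤ 2 * μ.real (G ∩ {η | η 1 = 1}) +
      μ.real (G ∩ {η | carrierFrom N 0 η = 0}) := by
    intro N
    have hz : MeasurableSet {η | carrierFrom N 0 η = 0} :=
      measurableSet_eq_fun (measurable_carrierFrom N 0) measurable_const
    have h1 : ∫ η, G.indicator (fun η => (carrierFrom N 0 η : ℝ)) η ∂μ ≤
        ∫ η, G.indicator (fun η => (carrierFrom (N + 1) 1 η : ℝ)) η ∂μ := by
      rw [hinv]
      refine integral_mono (hint _ _) (hint _ _) fun η => ?_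
      refine Set.indicator_le_indicator ?_
      exact Int.cast_le.2 (carrierFrom_le_succ N 0 η)
    have hi : ∀ S : Set Config, MeasurableSet S → Integrable (S.indicator (1 : Config → ℝ)) μ :=
      fun S hS => (integrable_const (1 : ℝ)).indicator hS
    have ha := (hi _ (hGm.inter (hm 1))).const_mul 2
    have hb : Integrable (fun η => 2 * (G ∩ {η | η 1 = 1}).indicator (1 : Config → ℝ) η +
        (G ∩ {η | carrierFrom N 0 η = 0}).indicator 1 η) μ := ha.add (hi _ (hGm.inter hz))
    have hb' : ∫ η, (2 * (G ∩ {η | η 1 = 1}).indicator (1 : Config → ℝ) η +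
        (G ∩ {η | carrierFrom N 0 η = 0}).indicator 1 η) ∂μ =
        2 * μ.real (G ∩ {η | η 1 = 1}) + μ.real (G ∩ {η | carrierFrom N 0 η = 0}) := by
      rw [integral_add ha (hi _ (hGm.inter hz)), integral_const_mul,
        integral_indicator_one (hGm.inter (hm 1)), integral_indicator_one (hGm.inter hz)]
    have h2 : ∫ η, (G.indicator (fun η => (carrierFrom (N + 1) 1 η : ℝ)) η +
        G.indicator 1 η) ∂μ ≤
        ∫ η, (G.indicator (fun η => (carrierFrom N 0 η : ℝ)) η +
        (2 * (G ∩ {η | η 1 = 1}).indicator 1 η +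
        (G ∩ {η | carrierFrom N 0 η = 0}).indicator 1 η)) ∂μ := by
      refine integral_mono ((hint _ _).add (hi G hGm)) ((hint _ _).add hb) fun η => ?_
      by_cases hη : η ∈ G
      · have h0 := carrierFrom_nonneg N 0 η
        simp only [Set.indicator, hη, if_true, Set.mem_inter_iff, true_and, Set.mem_ofPred_eq,
          carrierFrom, sub_self, Pi.one_apply]
        rcases fin_two_cases (η 1) with h | h
        · rw [h]
          by_cases hz0 : carrierFrom N 0 η = 0
          · simp [hz0]
          · simp only [Fin.val_zero, Nat.cast_zero, mul_zero, add_zero, zero_ne_one, if_false,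
              if_neg hz0]
            have : max (carrierFrom N 0 η - 1) 0 = carrierFrom N 0 η - 1 := max_eq_left (by omega)
            rw [this]
            push_cast
            linarith
        · rw [h]
          simp only [Fin.val_one, Nat.cast_one, mul_one, if_true]
          have : max (carrierFrom N 0 η + 2 - 1) 0 = carrierFrom N 0 η + 1 := by omega
          rw [this]
          push_cast
          split_ifs <;> linarith
      · simp [Set.indicator, hη]
    rw [integral_add (hint _ _) (hi G hGm), integral_add (hint _ _) hb, hb',
      integral_indicator_one hGm] at h2
    linarith
  -- Where the past maximum is infinite, the carrier at 0 is positive once it is started early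
  -- enough. In the limit `μ G ≤ 2 * ρ * μ G`, which forces `μ G = 0`.
  have hzero : Tendsto (fun N => μ (G ∩ {η | carrierFrom N 0 η = 0})) atTop (𝓝 (μ ∅)) := by
    refine tendsto_measure_of_ae_tendsto_indicator_of_isFiniteMeasure _ MeasurableSet.empty
      (fun N => hGm.inter (measurableSet_eq_fun (measurable_carrierFrom N 0) measurable_const))
      (ae_of_all _ fun η => ?_)
    by_cases hη : η ∈ G
    · obtain ⟨N, hN⟩ : ∃ N, carrierFrom N 0 η ≠ 0 := by
        by_contra! h
        exact hη (bbsDefined_of_carrierFrom_eq_zero h)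
      have hmono : Monotone fun N => carrierFrom N 0 η :=
        monotone_nat_of_le_succ fun N => carrierFrom_le_succ N 0 η
      filter_upwards [eventually_ge_atTop N] with M hM
      have h1 : carrierFrom N 0 η ≤ carrierFrom M 0 η := hmono hM
      have h2 := carrierFrom_nonneg N 0 η
      simp only [Set.mem_inter_iff, Set.mem_ofPred_eq, Set.mem_empty_iff_false, iff_false]
      omega
    · simp [hη]
  have hzero' : Tendsto (fun N => μ.real (G ∩ {η | carrierFrom N 0 η = 0})) atTop (𝓝 0) := by
    have := (ENNReal.tendsto_toReal (measure_ne_top μ ∅)).comp hzero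
    rw [measure_empty, ENNReal.toReal_zero] at this
    exact this
  have hfin := ge_of_tendsto' (hzero'.const_add (2 * μ.real (G ∩ {η | η 1 = 1}))) hineq
  rw [add_zero, hval] at hfin
  have hG0 : μ.real G = 0 := by
    have : 0 ≤ μ.real G := measureReal_nonneg
    nlinarith
  rw [measureReal_eq_zero_iff] at hG0
  rw [ae_iff]
  exact hG0

end Subcritical

theorem IsStationaryMarkovChain.map {Ω E : Type*} [MeasurableSpace Ω] [MeasurableSpace E]
    [MeasurableSingletonClass E] {P : Measure Ω} {X : Ω → ℤ → E} {Q : Matrix E E ℝ}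
    (hX : IsStationaryMarkovChain P X Q) : IsStationaryMarkovChain (P.map X) (fun x => x) Q where
  measurable := measurable_id
  stationary := by
    have hs : Measurable fun (x : ℤ → E) (n : ℤ) => x (n + 1) := by fun_prop
    rw [Measure.map_map hs hX.measurable, Measure.map_id']
    exact hX.stationary
  markov n k x := by
    have h1 := map_measureReal_apply (μ := P) hX.measurable (measurableSet_window n (k + 1) x)
    have h2 := map_measureReal_apply (μ := P) hX.measurable (measurableSet_window n k x)
    rw [h1, h2]
    exact hX.markov n k x

/-! ### Reversibility of the carrier of a two-state chain -/

section CarrierLaw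

variable {μ : Measure Config}

theorem map_carrier_shift (hdef : ∀ᵐ η ∂μ, BBSDefined η)
    (hshift : μ.map (fun η n => η (n + 1)) = μ) :
    μ.map (fun η n => carrier η (n + 1)) = μ.map carrier := by
  have hc : Measurable carrier := measurable_pi_iff.2 measurable_carrier
  have hs : Measurable fun (η : Config) (n : ℤ) => η (n + 1) := by fun_prop
  conv_rhs => rw [← hshift]
  rw [Measure.map_map hc hs]
  refine Measure.map_congr (hdef.mono fun η h => ?_)
  funext n
  exact (carrier_shift h 1 n).symm

/-- The pair of the carrier values on both sides of a site. -/
noncomputable def carrierEdge (η : Config) (n : ℤ) : ℤ × ℤ := (carrier η (n - 1), carrier η n)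

theorem measurable_carrierEdge : Measurable carrierEdge :=
  measurable_pi_iff.2 fun n => (measurable_carrier (n - 1)).prodMk (measurable_carrier n)

/-- The particle at a site, in terms of the carrier values on both sides. -/
def edgeParticle (p : ℤ × ℤ) : Fin 2 := if p.2 = p.1 + 1 then 1 else 0

/-- The probability to pass from one transition of the carrier to the next, when the particles form
a Markov chain. -/
def edgeKernel (Q : Matrix (Fin 2) (Fin 2) ℝ) (p q : ℤ × ℤ) : ℝ :=
  if q.1 = p.2 then
    if q.2 = p.2 + 1 then Q (edgeParticle p) 1
    else if q.2 = max (p.2 - 1) 0 then Q (edgeParticle p) 0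
    else 0
  else 0

theorem BBSDefined.eq_edgeParticle {η : Config} (h : BBSDefined η) (n : ℤ) :
    η n = edgeParticle (carrierEdge η n) := by
  conv_lhs => rw [← upSteps_carrier h]
  rfl

variable [IsProbabilityMeasure μ] {Q : Matrix (Fin 2) (Fin 2) ℝ}

/-- Two consecutive carrier values are needed for the Markov property: they reveal the particle
between them, which is the current state of the driving chain. -/
theorem measureReal_carrierEdge_window (hdef : ∀ᵐ η ∂μ, BBSDefined η)
    (hX : IsStationaryMarkovChain μ (fun x => x) Q) (hQ : ∀ x y, 0 ≤ Q x y)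
    (n : ℤ) (k : ℕ) (x : ℕ → ℤ × ℤ) :
    μ.real {η | ∀ i ≤ k + 1, carrierEdge η (n + (i : ℤ)) = x i} =
      μ.real {η | ∀ i ≤ k, carrierEdge η (n + (i : ℤ)) = x i} *
        edgeKernel Q (x k) (x (k + 1)) := by
  set A : Set Config := {η | BBSDefined η} ∩ {η | ∀ i ≤ k, carrierEdge η (n + (i : ℤ)) = x i}
    with hA
  have hAm : MeasurableSet A :=
    measurableSet_bbsDefined.inter (measurable_carrierEdge (measurableSet_window n k x))
  have hAp : IsPast (n + k) A := by
    rintro f g hfg ⟨hf, hfx⟩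
    refine ⟨BBSDefined.of_eq hf hfg, fun i hi => ?_⟩
    have e1 := carrier_eq_of_eq hf (n := n + i) fun j hj => hfg j (by omega)
    have e2 := carrier_eq_of_eq hf (n := n + i - 1) fun j hj => hfg j (by omega)
    rw [← hfx i hi, carrierEdge, carrierEdge, e1, e2]
  have hAs : ∀ η ∈ A, η (n + k) = edgeParticle (x k) := by
    rintro η ⟨h, hx⟩
    rw [h.eq_edgeParticle, ← hx k le_rfl]
  have hpast : ∀ y, μ.real {η | η ∈ A ∧ η (n + k + 1) = y} =
      μ.real {η | ∀ i ≤ k, carrierEdge η (n + (i : ℤ)) = x i} * Q (edgeParticle (x k)) y := by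
    intro y
    have h := hX.past hQ hAm hAp (edgeParticle (x k)) y
    have e1 : {η | η ∈ A ∧ η (n + k) = edgeParticle (x k) ∧ η (n + k + 1) = y} =
        {η | η ∈ A ∧ η (n + k + 1) = y} := by
      ext η
      exact ⟨fun h => ⟨h.1, h.2.2⟩, fun h => ⟨h.1, hAs η h.1, h.2⟩⟩
    have e2 : {η | η ∈ A ∧ η (n + k) = edgeParticle (x k)} = A := by
      ext η
      exact ⟨fun h => h.1, fun h => ⟨h, hAs η h⟩⟩
    have e3 : μ.real A = μ.real {η | ∀ i ≤ k, carrierEdge η (n + (i : ℤ)) = x i} :=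
      measureReal_congr (hdef.mono fun η h => propext ⟨fun h' => h'.2, fun h' => ⟨h, h'⟩⟩)
    rw [e1, e2, e3] at h
    exact h
  have hnext : μ.real {η | ∀ i ≤ k + 1, carrierEdge η (n + (i : ℤ)) = x i} =
      μ.real {η | η ∈ A ∧ (x (k + 1)).1 = (x k).2 ∧ carrier η (n + k + 1) = (x (k + 1)).2} := by
    refine measureReal_congr (hdef.mono fun η h => propext ?_)
    change (∀ i ≤ k + 1, carrierEdge η (n + (i : ℤ)) = x i) ↔
      (η ∈ A ∧ (x (k + 1)).1 = (x k).2 ∧ carrier η (n + k + 1) = (x (k + 1)).2)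
    have e1 : n + ((k + 1 : ℕ) : ℤ) = n + k + 1 := by push_cast; ring
    constructor
    · intro hx
      refine ⟨⟨h, fun i hi => hx i (by omega)⟩, ?_⟩
      have h1 := hx (k + 1) le_rfl
      rw [e1] at h1
      rw [← h1, ← hx k (by omega)]
      simp [carrierEdge]
    · rintro ⟨⟨-, hx⟩, h1, h2⟩ i hi
      rcases Nat.lt_or_ge k i with hk | hk
      · obtain rfl : i = k + 1 := by omega
        rw [e1]
        refine Prod.ext ?_ h2
        rw [h1, ← hx k le_rfl]
        simp [carrierEdge]
      · exact hx i hk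
  have hstep : ∀ η ∈ A, 0 ≤ (x k).2 ∧
      ((η (n + k + 1) = 1 ∧ carrier η (n + k + 1) = (x k).2 + 1) ∨
        (η (n + k + 1) = 0 ∧ carrier η (n + k + 1) = max ((x k).2 - 1) 0)) := by
    rintro η ⟨h, hx⟩
    have hk : carrier η (n + k) = (x k).2 := by rw [← hx k le_rfl]; rfl
    have h0 := h.carrier_nonneg (n + k)
    refine ⟨by omega, ?_⟩
    rcases fin_two_cases (η (n + k + 1)) with h1 | h1
    · right
      have := h.carrier_step_zero h1
      rw [add_sub_cancel_right, hk] at this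
      exact ⟨h1, this⟩
    · left
      have := h.carrier_step_one h1
      rw [add_sub_cancel_right, hk] at this
      exact ⟨h1, this⟩
  rw [hnext, edgeKernel]
  split_ifs with c1 c2 c3
  · rw [← hpast 1]
    congr 1
    ext η
    refine and_congr_right fun hη => ?_
    obtain ⟨h0, h | h⟩ := hstep η hη
    · exact ⟨fun _ => h.1, fun _ => ⟨c1, by omega⟩⟩
    · exact ⟨fun h' => by omega, fun h' => by rw [h.1] at h'; simp at h'⟩
  · rw [← hpast 0]
    congr 1
    ext η
    refine and_congr_right fun hη => ?_
    obtain ⟨h0, h | h⟩ := hstep η hη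
    · exact ⟨fun h' => by omega, fun h' => by rw [h.1] at h'; simp at h'⟩
    · exact ⟨fun _ => h.1, fun _ => ⟨c1, by omega⟩⟩
  · rw [mul_zero]
    convert measureReal_empty
    ext η
    simp only [Set.mem_ofPred_eq, Set.mem_empty_iff_false, iff_false]
    rintro ⟨hη, -, h'⟩
    obtain ⟨h0, h | h⟩ := hstep η hη <;> omega
  · rw [mul_zero]
    convert measureReal_empty
    ext η
    simp only [Set.mem_ofPred_eq, Set.mem_empty_iff_false, iff_false]
    rintro ⟨hη, h', -⟩
    exact c1 h'

/-- With two states, stationarity equates the flows 0 → 1 and 1 → 0, and this already is detailed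
balance. -/
theorem map_config_reverse (hX : IsStationaryMarkovChain μ (fun x => x) Q)
    (hQ : Q ∈ Matrix.rowStochastic ℝ (Fin 2)) : μ.map (fun η n => η (1 - n)) = μ := by
  obtain ⟨hQ0, hQ1⟩ := Matrix.mem_rowStochastic_iff_sum.1 hQ
  have hπ := hX.past_vecMul hQ0 (n := 0) (B := Set.univ) MeasurableSet.univ (fun _ _ _ _ => trivial)
  simp only [Set.mem_univ, true_and, hX.coord] at hπ
  have h0 := congrFun hπ 0
  have h1 := congrFun hπ 1
  simp only [Matrix.vecMul, dotProduct, Fin.sum_univ_two] at h0 h1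
  have q0 := hQ1 0
  have q1 := hQ1 1
  simp only [Fin.sum_univ_two] at q0 q1
  have h := map_reverse_eq (P := μ) (Y := fun x : Config => x) measurable_id
    (ν := fun e => μ.real {η | η 0 = e}) (R := Q) (fun n e => hX.coord n e) hX.markov
    (fun e => e) (fun e => rfl) (fun e => rfl) ?_ 1
  · simpa using h
  · intro a b
    rcases fin_two_cases a with rfl | rfl <;> rcases fin_two_cases b with rfl | rfl
    · rfl
    · rw [show Q 0 0 = 1 - Q 0 1 by linarith] at h0
      linarith
    · rw [show Q 0 0 = 1 - Q 0 1 by linarith] at h0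
      linarith
    · rfl

/-- Reversing time swaps the two ends of an edge, so detailed balance is required up to `Prod.swap`.
It follows from balance of crossings at each level together with stationarity of the edge chain; no
formula for the stationary law enters. -/
theorem map_carrier_reverse (hdef : ∀ᵐ η ∂μ, BBSDefined η)
    (hX : IsStationaryMarkovChain μ (fun x => x) Q)
    (hQ : Q ∈ Matrix.rowStochastic ℝ (Fin 2)) :
    μ.map (fun η n => carrier η (-n)) = μ.map carrier := by
  obtain ⟨hQ0, hQ1⟩ := Matrix.mem_rowStochastic_iff_sum.1 hQ
  have hc : Measurable carrier := measurable_pi_iff.2 measurable_carrier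
  have hshift : μ.map (fun η n => η (n + 1)) = μ := by
    have := hX.stationary
    rwa [Measure.map_id'] at this
  have hcs := map_carrier_shift hdef hshift
  have hm : ∀ i w : ℤ, MeasurableSet {w' : ℤ → ℤ | w' i = w} := fun i w => measurableSet_coord i w
  set ν : ℤ × ℤ → ℝ := fun e => μ.real {η | carrierEdge η 0 = e} with hν
  have hνn : ∀ n e, μ.real {η | carrierEdge η n = e} = ν e := by
    intro n e
    have h := measure_shift_eq hc hcs n ((hm (-1) e.1).inter (hm 0 e.2))
    simp only [hν, carrierEdge, Prod.ext_iff]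
    convert h using 4
    · simp [neg_add_eq_sub]
    · simp
  have hcut : ∀ a : ℤ, ν (a, a + 1) = ν (a + 1, a) := by
    intro a
    have := measureReal_up_eq_down (P := μ) (U := fun η => carrier η (0 - 1))
      (V := fun η => carrier η 0) (measurable_carrier _) (measurable_carrier _) ?_ ?_ a
    · simpa only [hν, carrierEdge, Prod.mk.injEq] using this
    · filter_upwards [hdef] with η h
      have h0 := h.carrier_nonneg (0 - 1)
      rw [abs_le]
      rcases fin_two_cases (η 0) with h1 | h1
      · have := h.carrier_step_zero h1
        omega
      · have := h.carrier_step_one h1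
        omega
    · intro w
      have h := measure_shift_eq hc hcs (-1)
        (measurableSet_le (measurable_pi_apply (0 : ℤ)) (measurable_const (a := w)))
      simpa using h
  have hνsupp : ∀ a b : ℤ, ν (a, b) ≠ 0 → 0 ≤ a ∧ 0 ≤ b ∧ (b = a + 1 ∨ b = max (a - 1) 0) := by
    intro a b
    contrapose!
    intro hab
    have h0 : μ.real {η | carrierEdge η 0 = (a, b)} = μ.real (∅ : Set Config) := by
      refine measureReal_congr (hdef.mono fun η h => propext ?_)
      change carrierEdge η 0 = (a, b) ↔ False
      simp only [carrierEdge, Prod.mk.injEq, iff_false]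
      rintro ⟨h1, h2⟩
      have h3 := h.carrier_nonneg (0 - 1)
      have h4 := h.carrier_nonneg 0
      obtain ⟨h5, h6⟩ := hab (by omega) (by omega)
      rcases fin_two_cases (η 0) with h7 | h7
      · have := h.carrier_step_zero h7
        omega
      · have := h.carrier_step_one h7
        omega
    rw [measureReal_empty] at h0
    exact h0
  have hνsymm : ∀ a b : ℤ, ν (b, a) = ν (a, b) := by
    have hsupp : ∀ a b : ℤ, ν (a, b) ≠ 0 → ν (b, a) = ν (a, b) := by
      intro a b h
      obtain ⟨h1, h2, h3⟩ := hνsupp a b h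
      rcases lt_trichotomy a b with hab | rfl | hab
      · obtain rfl : b = a + 1 := by omega
        exact (hcut a).symm
      · rfl
      · obtain rfl : a = b + 1 := by omega
        exact hcut b
    intro a b
    by_cases h : ν (a, b) = 0
    · by_cases h' : ν (b, a) = 0
      · rw [h, h']
      · exact (hsupp b a h').symm
    · exact hsupp a b h
  have hpair : ∀ e e' : ℤ × ℤ, μ.real {η | carrierEdge η 0 = e ∧ carrierEdge η 1 = e'} =
      ν e * edgeKernel Q e e' := by
    intro e e'
    have h := measureReal_carrierEdge_window hdef hX hQ0 0 0 (fun i => if i = 0 then e else e')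
    simp only [zero_add, if_true, one_ne_zero, if_false] at h
    have e1 : {η : Config | ∀ i ≤ (0 : ℕ), carrierEdge η (i : ℤ) = if i = 0 then e else e'} =
        {η | carrierEdge η 0 = e} := by
      ext η
      simp
    have e2 : {η : Config | ∀ i ≤ (1 : ℕ), carrierEdge η (i : ℤ) = if i = 0 then e else e'} =
        {η | carrierEdge η 0 = e ∧ carrierEdge η 1 = e'} := by
      ext η
      simp only [Set.mem_ofPred_eq]
      constructor
      · intro h
        exact ⟨by simpa using h 0 (by omega), by simpa using h 1 le_rfl⟩
      · rintro ⟨h1, h2⟩ i hi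
        interval_cases i
        · simpa using h1
        · simpa using h2
    rw [e1, e2] at h
    exact h
  have hflow : ∀ b d : ℤ, ν (b, d) =
      ∑ a ∈ {b - 1, b, b + 1}, ν (a, b) * edgeKernel Q (a, b) (b, d) := by
    intro b d
    rw [← hνn 1 (b, d)]
    simp only [← hpair]
    have hdisj : Set.PairwiseDisjoint (({b - 1, b, b + 1} : Finset ℤ) : Set ℤ)
        fun a => {η | carrierEdge η 0 = (a, b) ∧ carrierEdge η 1 = (b, d)} := by
      intro i _ j _ hij
      refine Set.disjoint_left.2 fun η h1 h2 => hij ?_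
      have := h1.1.symm.trans h2.1
      exact congrArg Prod.fst this
    have hme : ∀ (i : ℤ) (e : ℤ × ℤ), MeasurableSet {η | carrierEdge η i = e} := fun i e =>
      measurable_carrierEdge (measurableSet_coord i e)
    rw [← measureReal_biUnion_finset hdisj fun a _ => (hme 0 (a, b)).inter (hme 1 (b, d))]
    refine measureReal_congr (hdef.mono fun η h => propext ?_)
    change carrierEdge η 1 = (b, d) ↔
      η ∈ ⋃ a ∈ ({b - 1, b, b + 1} : Finset ℤ),
        {η | carrierEdge η 0 = (a, b) ∧ carrierEdge η 1 = (b, d)}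
    simp only [Set.mem_iUnion, Set.mem_ofPred_eq, exists_prop, Finset.mem_insert,
      Finset.mem_singleton]
    constructor
    · intro h1
      refine ⟨carrier η (0 - 1), ?_, ?_, h1⟩
      · have hb : carrier η 0 = b := congrArg Prod.fst h1
        have h0 := h.carrier_nonneg (0 - 1)
        rcases fin_two_cases (η 0) with h2 | h2
        · have := h.carrier_step_zero h2
          omega
        · have := h.carrier_step_one h2
          omega
      · have hb : carrier η 0 = b := congrArg Prod.fst h1
        rw [carrierEdge, hb]
    · rintro ⟨a, -, -, h1⟩
      exact h1
  have q0 := hQ1 0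
  simp only [Fin.sum_univ_two] at q0
  -- Balance for the up-edge out of `b`: it is entered by continuing an ascent to `b` (from `(0, 0)`
  -- when `b = 0`) or by turning after the descent from `b + 1`. Its weight equals that of this
  -- descent by `hcut`, and subtracting the turns, of rate `Q 0 1`, leaves the continued descents,
  -- of rate `Q 0 0 = 1 - Q 0 1`.
  have hmain : ∀ b : ℤ, 0 ≤ b →
      ν (max (b - 1) 0, b) * edgeKernel Q (max (b - 1) 0, b) (b, b + 1) =
        ν (b + 1, b) * edgeKernel Q (b + 1, b) (b, max (b - 1) 0) := by
    intro b hb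
    have h := hflow b (b + 1)
    rw [Finset.sum_insert (by simp; omega), Finset.sum_pair (by simp), hcut b] at h
    rcases hb.eq_or_lt with rfl | hb
    · have h1 : ν (0 - 1, 0) = 0 := by
        by_contra h1
        have := hνsupp _ _ h1
        omega
      rw [h1] at h
      have e : ¬ (0 : ℤ) = 1 + 1 := by norm_num
      simp only [e, edgeKernel, edgeParticle, zero_sub, zero_add, max_eq_right, Left.neg_nonpos_iff,
        zero_le_one, if_true, zero_ne_one, if_false, zero_mul] at h ⊢
      rw [show Q 0 0 = 1 - Q 0 1 by linarith]
      linarith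
    · have h1 : ν (b, b) = 0 := by
        by_contra h1
        have := hνsupp _ _ h1
        omega
      rw [h1] at h
      rw [max_eq_left (by omega : (0 : ℤ) ≤ b - 1)]
      have e1 : edgeKernel Q (b - 1, b) (b, b + 1) = Q 1 1 := by
        simp [edgeKernel, edgeParticle]
      have e2 : edgeKernel Q (b + 1, b) (b, b + 1) = Q 0 1 := by
        simp [edgeKernel, edgeParticle, add_assoc]
      have e3 : edgeKernel Q (b + 1, b) (b, b - 1) = Q 0 0 := by
        simp only [edgeKernel, edgeParticle]
        rw [if_pos trivial, if_neg (by omega), if_pos (by omega), if_neg (by omega)]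
      rw [e1, e2] at h
      rw [e1, e3, show Q 0 0 = 1 - Q 0 1 by linarith]
      linarith
  have hbal : ∀ e e' : ℤ × ℤ,
      ν e * edgeKernel Q e e' = ν e'.swap * edgeKernel Q e'.swap e.swap := by
    rintro ⟨a, b⟩ ⟨b', d⟩
    simp only [Prod.swap_prod_mk]
    by_cases hb : b' = b
    · subst hb
      by_cases hb0 : 0 ≤ b'
      -- A level `a` that is not next to `b'` makes both sides vanish: one through the weight of the
      -- edge, the other through the kernel.
      · have hbad : ∀ a d, ¬ (a = b' + 1 ∨ a = max (b' - 1) 0) →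
            ν (a, b') = 0 ∧ edgeKernel Q (d, b') (b', a) = 0 := by
          intro a d had
          constructor
          · by_contra h1
            have := hνsupp _ _ h1
            omega
          · simp only [edgeKernel]
            rw [if_pos trivial, if_neg (by omega), if_neg (by omega)]
        by_cases ha : a = b' + 1 ∨ a = max (b' - 1) 0
        · by_cases hd : d = b' + 1 ∨ d = max (b' - 1) 0
          · rcases ha with rfl | rfl <;> rcases hd with rfl | rfl
            · rfl
            · exact (hmain b' hb0).symm
            · exact hmain b' hb0
            · rfl
          · rw [(hbad d a hd).1, (hbad d a hd).2]
            simp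
        · rw [(hbad a d ha).1, (hbad a d ha).2]
          simp
      · have h0 : ∀ a, ν (a, b') = 0 := by
          intro a
          by_contra h1
          exact hb0 (hνsupp _ _ h1).2.1
        rw [h0, h0, zero_mul, zero_mul]
    · simp only [edgeKernel]
      rw [if_neg hb, if_neg (Ne.symm hb), mul_zero, mul_zero]
  have h := map_reverse_eq (P := μ) measurable_carrierEdge hνn
    (measureReal_carrierEdge_window hdef hX hQ0) Prod.swap Prod.swap_swap
    (fun e => hνsymm e.1 e.2) hbal 1
  have hsnd : Measurable fun (y : ℤ → ℤ × ℤ) (n : ℤ) => (y n).2 := by fun_prop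
  have h' := congrArg (fun ν => ν.map fun (y : ℤ → ℤ × ℤ) (n : ℤ) => (y n).2) h
  have hms : Measurable fun (η : Config) (n : ℤ) => (carrierEdge η (1 - n)).swap :=
    measurable_pi_iff.2 fun n =>
      measurable_swap.comp ((measurable_pi_apply (1 - n)).comp measurable_carrierEdge)
  rw [Measure.map_map hsnd hms, Measure.map_map hsnd measurable_carrierEdge] at h'
  have e1 : ((fun (y : ℤ → ℤ × ℤ) (n : ℤ) => (y n).2) ∘
      fun (η : Config) (n : ℤ) => (carrierEdge η (1 - n)).swap) =
      fun η n => carrier η (-n) := by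
    funext η n
    simp only [Function.comp, carrierEdge, Prod.snd_swap]
    congr 1
    ring
  rw [e1] at h'
  exact h'

end CarrierLaw

/-! ### The i.i.d. and Markov examples -/

section TwoStates

variable {Ω : Type*} [MeasurableSpace Ω] {P : Measure Ω} [IsProbabilityMeasure P]

/-- The value `p₀ = 0` is admitted so that the empty i.i.d. configuration is covered as well. Column
0 is positive, which gives the Doeblin condition. -/
theorem ergodic_bbs_of_two_states {p₀ p₁ : ℝ} (h0 : 0 ≤ p₀) (h0' : p₀ < 1) (h1 : 0 ≤ p₁)
    (h1' : p₁ < 1) (hp : p₀ + p₁ < 1) {η : Ω → Config}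
    (hη : IsStationaryMarkovChain P η !![1 - p₀, p₀; 1 - p₁, p₁]) :
    (∀ᵐ ω ∂P, BBSDefined (η ω)) ∧ Ergodic bbs (P.map η) := by
  set μ := P.map η with hμ
  have : IsProbabilityMeasure μ := Measure.isProbabilityMeasure_map hη.measurable.aemeasurable
  set Q : Matrix (Fin 2) (Fin 2) ℝ := !![1 - p₀, p₀; 1 - p₁, p₁] with hQdef
  have hX : IsStationaryMarkovChain μ (fun x => x) Q := hη.map
  have hQ0 : ∀ x y, 0 ≤ Q x y := by
    intro x y
    fin_cases x <;> fin_cases y <;> simp [hQdef] <;> linarith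
  have hQ : Q ∈ Matrix.rowStochastic ℝ (Fin 2) := by
    refine Matrix.mem_rowStochastic_iff_sum.2 ⟨hQ0, fun x => ?_⟩
    fin_cases x <;> simp [hQdef]
  have hD : IsDoeblin Q := by
    refine ⟨0, 0, fun x => ?_⟩
    fin_cases x <;> simp [hQdef] <;> linarith
  have hid : (μ.map fun x : Config => ofTransitions (fun _ y => y) x) = μ := Measure.map_id
  have hshift : μ.map (fun η n => η (n + 1)) = μ := by
    have := hX.stationary
    rwa [Measure.map_id'] at this
  -- Stationarity reads `π₁ (1 - p₁) = π₀ p₀`, and `p₀ < 1 - p₁` then gives `π₁ < π₀`.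
  have hρ : μ.real {η | η 0 = 1} < 1 / 2 := by
    have hπ := congrFun (hX.past_vecMul hQ0 (n := 0) (B := Set.univ) MeasurableSet.univ
      (fun _ _ _ _ => trivial)) 1
    have hs := sum_measureReal_coord (P := μ) hX.measurable 0 Set.univ
    simp only [Set.mem_univ, true_and, hX.coord, Matrix.vecMul, dotProduct, Fin.sum_univ_two]
      at hπ hs
    rw [probReal_univ] at hs
    have e1 : Q 0 1 = p₀ := by simp [hQdef]
    have e2 : Q 1 1 = p₁ := by simp [hQdef]
    rw [e1, e2] at hπ
    nlinarith
  have hdef : ∀ᵐ η ∂μ, BBSDefined η := by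
    refine ae_bbsDefined hshift hρ fun n B hB hBn => ?_
    have := hX.tendsto_particle hQ hD (fun _ y => y) n hB hBn
    rwa [hid] at this
  have hT : MeasurePreserving bbs μ μ :=
    measurePreserving_bbs hdef (map_config_reverse hX hQ) (map_carrier_reverse hdef hX hQ)
  refine ⟨ae_of_ae_map hη.measurable.aemeasurable hdef, ?_⟩
  have := hX.ergodic_bbs hQ hD (fun _ y => y) (by rwa [hid]) (by rwa [hid]) (by rwa [hid])
  rwa [hid] at this

theorem isStationaryMarkovChain_of_iid {p : ℝ} {η : Ω → Config} (hm : Measurable η)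
    (hind : iIndepFun (fun (n : ℤ) (ω : Ω) => η ω n) P)
    (hp : ∀ n : ℤ, P.real {ω | η ω n = 1} = p) :
    IsStationaryMarkovChain P η !![1 - p, p; 1 - p, p] := by
  have hq : ∀ (n : ℤ) (a : Fin 2), P.real {ω | η ω n = a} = if a = 1 then p else 1 - p := by
    intro n a
    rcases fin_two_cases a with rfl | rfl
    · have h := sum_measureReal_coord (P := P) hm n Set.univ
      simp only [Set.mem_univ, true_and, Fin.sum_univ_two, hp, probReal_univ] at h
      simp only [zero_ne_one, if_false]
      linarith
    · simpa using hp n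
  have hwin : ∀ (n : ℤ) (k : ℕ) (x : ℕ → Fin 2),
      P.real {ω | ∀ i ≤ k, η ω (n + (i : ℤ)) = x i} =
        ∏ i ∈ Finset.range (k + 1), if x i = 1 then p else 1 - p := by
    intro n k x
    have hinj : Function.Injective fun i : ℕ => n + (i : ℤ) := fun a b h => by simpa using h
    have hprec := hind.precomp hinj
    have h := hprec.measure_inter_preimage_eq_mul (Finset.range (k + 1))
      (sets := fun i => {x i}) fun i _ => measurableSet_singleton _
    have e : {ω | ∀ i ≤ k, η ω (n + (i : ℤ)) = x i} =
        ⋂ i ∈ Finset.range (k + 1), (fun ω => η ω (n + (i : ℤ))) ⁻¹' {x i} := by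
      ext ω
      simp
    rw [e, measureReal_def]
    rw [h, ENNReal.toReal_prod]
    exact Finset.prod_congr rfl fun i _ => hq _ _
  refine ⟨hm, ?_, ?_⟩
  · have hm' : Measurable fun ω n => η ω (n + 1) := by fun_prop
    refine ext_of_int_windows fun n k x => ?_
    have hw := measurableSet_window n k x
    rw [← measureReal_eq_measureReal_iff, map_measureReal_apply hm' hw,
      map_measureReal_apply hm hw]
    have h1 := hwin n k x
    have h2 := hwin (n + 1) k x
    rw [← h1] at h2
    have e : (fun ω n => η ω (n + 1)) ⁻¹' {f : Config | ∀ i ≤ k, f (n + (i : ℤ)) = x i} =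
        {ω | ∀ i ≤ k, η ω (n + 1 + (i : ℤ)) = x i} := by
      ext ω
      simp [add_right_comm]
    rw [e]
    exact h2
  · intro n k x
    rw [hwin, hwin, Finset.prod_range_succ]
    congr 1
    rcases fin_two_cases (x k) with h | h <;> rcases fin_two_cases (x (k + 1)) with h' | h' <;>
      simp [h, h']

end TwoStates

/-! ### The restricted walk and its duality -/

section RestrictedWalk

variable {K : ℕ} {p : ℝ}

/-- The particle carried by a transition of the carrier. -/
def upStep (K : ℕ) (x y : Fin (K + 1)) : Fin 2 := if (y : ℕ) = (x : ℕ) + 1 then 1 else 0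

/-- The part of the restricted walk that produces the particle `e`. -/
noncomputable def walkPart (p : ℝ) (K : ℕ) (e : Fin 2) : Matrix (Fin (K + 1)) (Fin (K + 1)) ℝ :=
  fun x y => if upStep K x y = e then restrictedWalk p K x y else 0

/-- The intertwiner between the restricted walk and its transpose. -/
def dualityMatrix (K : ℕ) : Matrix (Fin (K + 1)) (Fin (K + 1)) ℝ :=
  fun x y => if (x : ℕ) + (y : ℕ) ≤ K then 1 else 0

theorem walkPart_one (x y : Fin (K + 1)) :
    walkPart p K 1 x y = if (y : ℕ) = (x : ℕ) + 1 then p else 0 := by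
  simp only [walkPart, upStep, restrictedWalk]
  split_ifs <;> simp_all

/-- Truncated subtraction merges the step down and the stay at 0 into one formula. -/
theorem walkPart_zero (x y : Fin (K + 1)) :
    walkPart p K 0 x y = if (y : ℕ) = (x : ℕ) - 1 then 1 - p else 0 := by
  simp only [walkPart, upStep, restrictedWalk]
  split_ifs <;> first | rfl | omega

theorem walkPart_add : walkPart p K 0 + walkPart p K 1 = restrictedWalk p K := by
  ext x y
  simp only [Matrix.add_apply, walkPart]
  rcases fin_two_cases (upStep K x y) with h | h <;> simp [h]

theorem sum_ite_val_eq (m : ℕ) (g : ℕ → ℝ) :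
    ∑ z : Fin (K + 1), (if (z : ℕ) = m then g z else 0) = if m ≤ K then g m else 0 := by
  rw [Fin.sum_univ_eq_sum_range (fun z => if z = m then g z else 0), Finset.sum_ite_eq']
  simp

theorem restrictedWalk_mulVec (u : ℕ → ℝ) (x : Fin (K + 1)) :
    (restrictedWalk p K).mulVec (fun z => u z) x =
      (1 - p) * u ((x : ℕ) - 1) + if (x : ℕ) + 1 ≤ K then p * u (x + 1) else 0 := by
  rw [← walkPart_add, Matrix.add_mulVec]
  simp only [Pi.add_apply, Matrix.mulVec, dotProduct, walkPart_one, walkPart_zero, ite_mul,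
    zero_mul]
  rw [sum_ite_val_eq _ fun z => (1 - p) * u z, sum_ite_val_eq _ fun z => p * u z,
    if_pos (by omega)]

/-- Both sides are a constant times the indicator of `x + y + 1 ≤ K` for a particle, and of `(x - 1)
+ y ≤ K`, equivalently `x + (y - 1) ≤ K`, for a hole. The intertwining holds for each letter
separately, so it extends to words, where transposition reverses the order. -/
theorem walkPart_mul_dualityMatrix (e : Fin 2) :
    walkPart p K e * dualityMatrix K = dualityMatrix K * (walkPart p K e).transpose := by
  ext x y
  simp only [Matrix.mul_apply, Matrix.transpose_apply, dualityMatrix]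
  have hl : ∀ (m q : ℕ) (r : ℝ) (z : Fin (K + 1)), ((if (z : ℕ) = m then r else 0) *
      if (z : ℕ) + q ≤ K then 1 else 0) =
      if (z : ℕ) = m then (if (z : ℕ) + q ≤ K then r else 0) else 0 := by
    intro m q r z
    split_ifs <;> simp
  have hr : ∀ (m q : ℕ) (r : ℝ) (z : Fin (K + 1)), ((if q + (z : ℕ) ≤ K then 1 else 0) *
      if (z : ℕ) = m then r else 0) =
      if (z : ℕ) = m then (if q + (z : ℕ) ≤ K then r else 0) else 0 := by
    intro m q r z
    split_ifs <;> simp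
  rcases fin_two_cases e with rfl | rfl
  · simp only [walkPart_zero, hl, hr]
    rw [sum_ite_val_eq _ fun z => if z + y ≤ K then 1 - p else 0,
      sum_ite_val_eq _ fun z => if x + z ≤ K then 1 - p else 0]
    split_ifs <;> first | rfl | omega
  · simp only [walkPart_one, hl, hr]
    rw [sum_ite_val_eq _ fun z => if z + y ≤ K then p else 0,
      sum_ite_val_eq _ fun z => if x + z ≤ K then p else 0]
    split_ifs <;> first | rfl | omega

theorem prod_walkPart_mul_dualityMatrix (l : List (Fin 2)) :
    (l.map (walkPart p K)).prod * dualityMatrix K =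
      dualityMatrix K * ((l.reverse.map (walkPart p K)).prod).transpose := by
  induction l with
  | nil => simp
  | cons e l ih =>
    rw [List.map_cons, List.prod_cons, Matrix.mul_assoc, ih, ← Matrix.mul_assoc,
      walkPart_mul_dualityMatrix, Matrix.mul_assoc, ← Matrix.transpose_mul, List.reverse_cons,
      List.map_append, List.prod_append]
    simp

theorem dualityMatrix_transpose : (dualityMatrix K).transpose = dualityMatrix K := by
  ext x y
  simp [dualityMatrix, add_comm]

/-- The weight of a word is the weight of the reversed word. -/
theorem dotProduct_prod_walkPart_reverse (g : Fin (K + 1) → ℝ) (l : List (Fin 2)) :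
    Matrix.vecMul g (l.map (walkPart p K)).prod ⬝ᵥ (dualityMatrix K).mulVec g =
      Matrix.vecMul g (l.reverse.map (walkPart p K)).prod ⬝ᵥ (dualityMatrix K).mulVec g := by
  have h : ∀ N : Matrix (Fin (K + 1)) (Fin (K + 1)) ℝ,
      g ⬝ᵥ N.transpose.mulVec g = g ⬝ᵥ N.mulVec g := by
    intro N
    rw [Matrix.mulVec_transpose, dotProduct_comm, Matrix.dotProduct_mulVec]
  rw [← Matrix.dotProduct_mulVec, Matrix.mulVec_mulVec, prod_walkPart_mul_dualityMatrix, ← h,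
    Matrix.transpose_mul, Matrix.transpose_transpose, dualityMatrix_transpose,
    ← Matrix.mulVec_mulVec, Matrix.dotProduct_mulVec]

/-- The eigenvalue equation is a three-term recursion with leading coefficient `p ≠ 0`, so the value
at 0 determines the vector: eigenspaces are at most one-dimensional. -/
theorem eq_zero_of_restrictedWalk_mulVec (hp : 0 < p) {lam : ℝ} {w : Fin (K + 1) → ℝ}
    (hw : (restrictedWalk p K).mulVec w = lam • w) (h0 : w 0 = 0) : w = 0 := by
  set u : ℕ → ℝ := fun n => if h : n < K + 1 then w ⟨n, h⟩ else 0 with hu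
  have hwu : w = fun z : Fin (K + 1) => u z := by
    funext z
    simp only [hu, dif_pos z.2]
  have hrec : ∀ m, m + 1 ≤ K → (1 - p) * u (m - 1) + p * u (m + 1) = lam * u m := by
    intro m hm
    have h := congrFun hw ⟨m, by omega⟩
    rw [hwu, restrictedWalk_mulVec] at h
    simp only [Pi.smul_apply, smul_eq_mul, if_pos hm] at h
    exact h
  have hall : ∀ m, ∀ i ≤ m, i ≤ K → u i = 0 := by
    intro m
    induction m with
    | zero =>
      intro i hi _
      obtain rfl : i = 0 := by omega
      simpa [hu] using h0
    | succ m ih =>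
      intro i hi hiK
      rcases Nat.lt_or_ge m i with h | h
      · obtain rfl : i = m + 1 := by omega
        have h1 := hrec m hiK
        rw [ih (m - 1) (by omega) (by omega), ih m le_rfl (by omega)] at h1
        have : p * u (m + 1) = 0 := by linarith
        exact (mul_eq_zero.1 this).resolve_left hp.ne'
      · exact ih i h hiK
  rw [hwu]
  funext z
  exact hall z z le_rfl (by omega)

end RestrictedWalk

/-! ### The Doob transform is stochastic and Doeblin -/

section Doob

variable {K : ℕ} {p lam : ℝ} {h : Fin (K + 1) → ℝ}

theorem restrictedWalk_nonneg (hp0 : 0 < p) (hp1 : p < 1) (x y : Fin (K + 1)) :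
    0 ≤ restrictedWalk p K x y := by
  simp only [restrictedWalk]
  split_ifs <;> linarith

theorem IsPerronPair.lam_pos (hp0 : 0 < p) (hp1 : p < 1)
    (hh : IsPerronPair (restrictedWalk p K) lam h) : 0 < lam := by
  have h0 := congrFun hh.2 0
  have h1 : (1 - p) * h 0 ≤ (restrictedWalk p K).mulVec h 0 := by
    have : restrictedWalk p K 0 0 = 1 - p := by simp [restrictedWalk]
    rw [← this]
    exact Finset.single_le_sum (f := fun y => restrictedWalk p K 0 y * h y)
      (fun y _ => mul_nonneg (restrictedWalk_nonneg hp0 hp1 0 y) (hh.1 y).le) (Finset.mem_univ 0)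
  rw [h0, Pi.smul_apply, smul_eq_mul] at h1
  have h2 := hh.1 0
  nlinarith

theorem doobTransform_nonneg (hp0 : 0 < p) (hp1 : p < 1)
    (hh : IsPerronPair (restrictedWalk p K) lam h) (x y : Fin (K + 1)) :
    0 ≤ doobTransform (restrictedWalk p K) lam h x y :=
  div_nonneg (mul_nonneg (restrictedWalk_nonneg hp0 hp1 x y) (hh.1 y).le)
    (mul_nonneg (hh.lam_pos hp0 hp1).le (hh.1 x).le)

theorem doobTransform_pos (hp0 : 0 < p) (hp1 : p < 1)
    (hh : IsPerronPair (restrictedWalk p K) lam h) {x y : Fin (K + 1)}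
    (hxy : 0 < restrictedWalk p K x y) :
    0 < doobTransform (restrictedWalk p K) lam h x y :=
  div_pos (mul_pos hxy (hh.1 y)) (mul_pos (hh.lam_pos hp0 hp1) (hh.1 x))

theorem doobTransform_mem_rowStochastic (hp0 : 0 < p) (hp1 : p < 1)
    (hh : IsPerronPair (restrictedWalk p K) lam h) :
    doobTransform (restrictedWalk p K) lam h ∈ Matrix.rowStochastic ℝ (Fin (K + 1)) := by
  refine Matrix.mem_rowStochastic_iff_sum.2 ⟨doobTransform_nonneg hp0 hp1 hh, fun x => ?_⟩
  have h1 := congrFun hh.2 x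
  simp only [Matrix.mulVec, dotProduct, Pi.smul_apply, smul_eq_mul] at h1
  simp only [doobTransform]
  rw [← Finset.sum_div, h1]
  exact div_self (mul_pos (hh.lam_pos hp0 hp1) (hh.1 x)).ne'

/-- The path that descends to 0 and then waits there has positive weight. -/
theorem doobTransform_pow_pos (hp0 : 0 < p) (hp1 : p < 1)
    (hh : IsPerronPair (restrictedWalk p K) lam h) (n : ℕ) (x : Fin (K + 1)) (hx : (x : ℕ) ≤ n) :
    0 < (doobTransform (restrictedWalk p K) lam h ^ n) x 0 := by
  have hQ := doobTransform_mem_rowStochastic hp0 hp1 hh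
  induction n generalizing x with
  | zero =>
    have : x = 0 := Fin.ext (by simpa using hx)
    simp [this]
  | succ n ih =>
    rw [pow_succ', Matrix.mul_apply]
    refine Finset.sum_pos' (fun y _ => mul_nonneg (doobTransform_nonneg hp0 hp1 hh x y)
      ((Matrix.mem_rowStochastic_iff_sum.1 (pow_mem hQ n)).1 y 0))
      ⟨⟨(x : ℕ) - 1, by omega⟩, Finset.mem_univ _, ?_⟩
    refine mul_pos (doobTransform_pos hp0 hp1 hh ?_) (ih _ (by simp only; omega))
    simp only [restrictedWalk]
    rw [if_neg (by omega), if_pos (by omega)]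
    linarith

theorem isDoeblin_doobTransform (hp0 : 0 < p) (hp1 : p < 1)
    (hh : IsPerronPair (restrictedWalk p K) lam h) :
    IsDoeblin (doobTransform (restrictedWalk p K) lam h) :=
  ⟨K, 0, fun x => doobTransform_pow_pos hp0 hp1 hh (K + 1) x (by omega)⟩

end Doob

/-! ### The conditioned carrier: identification and reversibility -/

section BoundedCarrier

variable {Ω : Type*} [MeasurableSpace Ω] {P : Measure Ω} {K : ℕ} {p lam : ℝ}
  {h : Fin (K + 1) → ℝ} {W : Ω → ℤ → Fin (K + 1)}

theorem IsStationaryMarkovChain.pair {E : Type*} [Fintype E] [DecidableEq E] [MeasurableSpace E]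
    [MeasurableSingletonClass E] {X : Ω → ℤ → E} {Q : Matrix E E ℝ}
    (hX : IsStationaryMarkovChain P X Q) (n : ℤ) (x y : E) :
    P.real {ω | X ω n = x ∧ X ω (n + 1) = y} = P.real {ω | X ω 0 = x} * Q x y := by
  have h := hX.markov n 0 (fun i => if i = 0 then x else y)
  simp only [if_true, zero_add, one_ne_zero, if_false] at h
  have e1 : {ω | ∀ i ≤ (0 : ℕ), X ω (n + (i : ℤ)) = if i = 0 then x else y} =
      {ω | X ω n = x} := by
    ext ω
    simp
  have e2 : {ω | ∀ i ≤ (1 : ℕ), X ω (n + (i : ℤ)) = if i = 0 then x else y} =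
      {ω | X ω n = x ∧ X ω (n + 1) = y} := by
    ext ω
    simp only [Set.mem_ofPred_eq]
    constructor
    · intro h
      exact ⟨by simpa using h 0 (by omega), by simpa using h 1 le_rfl⟩
    · rintro ⟨h1, h2⟩ i hi
      interval_cases i
      · simpa using h1
      · simpa using h2
  rw [e1, e2, hX.coord] at h
  exact h

variable [IsProbabilityMeasure P]

theorem IsStationaryMarkovChain.ae_transition {E : Type*} [Fintype E] [DecidableEq E]
    [MeasurableSpace E] [MeasurableSingletonClass E] {X : Ω → ℤ → E} {Q : Matrix E E ℝ}
    (hX : IsStationaryMarkovChain P X Q) : ∀ᵐ ω ∂P, ∀ n, Q (X ω n) (X ω (n + 1)) ≠ 0 := by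
  refine ae_all_iff.2 fun n => ?_
  have h : ∀ᵐ ω ∂P, ∀ x y, Q x y = 0 → ¬ (X ω n = x ∧ X ω (n + 1) = y) := by
    refine ae_all_iff.2 fun x => ae_all_iff.2 fun y => ?_
    by_cases hxy : Q x y = 0
    · have := hX.pair n x y
      rw [hxy, mul_zero, measureReal_eq_zero_iff] at this
      filter_upwards [measure_eq_zero_iff_ae_notMem.1 this] with ω hω _ using hω
    · exact ae_of_all _ fun ω h => absurd h hxy
  filter_upwards [h] with ω hω h0
  exact hω _ _ h0 ⟨rfl, rfl⟩

/-- A Doeblin chain visits the state of the positive column in the remote past. -/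
theorem IsStationaryMarkovChain.ae_exists_visit {E : Type*} [Fintype E] [DecidableEq E]
    [MeasurableSpace E] [MeasurableSingletonClass E] {X : Ω → ℤ → E} {Q : Matrix E E ℝ}
    (hX : IsStationaryMarkovChain P X Q) (hQ : Q ∈ Matrix.rowStochastic ℝ E) (hD : IsDoeblin Q)
    {e : E} (he : 0 < P.real {ω | X ω 0 = e}) : ∀ᵐ ω ∂P, ∀ n, ∃ m ≤ n, X ω m = e := by
  set A : ℤ → Set (ℤ → E) := fun n => {x | ∀ k ≤ n, x k ≠ e} with hA
  have hAm : ∀ n, MeasurableSet (A n) := by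
    intro n
    have : A n = ⋂ k : Set.Iic n, {x : ℤ → E | x k = e}ᶜ := by
      ext x
      simp [hA]
    rw [this]
    exact MeasurableSet.iInter fun k => (measurableSet_coord (k : ℤ) e).compl
  have hAp : ∀ n, IsPast n (A n) := fun n f g hfg hf k hk => by
    rw [← hfg k hk]
    exact hf k hk
  have hconst : ∀ n, P.real (X ⁻¹' A n) = P.real (X ⁻¹' A 0) := by
    intro n
    have h := measure_shift_eq hX.measurable hX.stationary n (hAm 0)
    have e1 : {ω | (fun k => X ω (k + n)) ∈ A 0} = X ⁻¹' A n := by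
      ext ω
      simp only [hA, Set.mem_ofPred_eq, Set.mem_preimage]
      constructor
      · intro hω k hk
        have := hω (k - n) (by omega)
        rwa [sub_add_cancel] at this
      · intro hω k hk
        exact hω (k + n) (by omega)
    rw [e1] at h
    exact h
  -- The events `A m` decrease in `m` but all have the same probability, so a first visit to `e` in
  -- the times from 1 to `m` has probability 0. Mixing then forces `P (A 0) * P (X 0 = e) = 0`.
  have hzero : ∀ m : ℕ, P.real {ω | X ω ∈ A 0 ∧ X ω (0 + (m : ℤ)) = e} = 0 := by
    intro m
    have hsub : X ⁻¹' A m ⊆ X ⁻¹' A 0 := fun ω hω k hk => hω k (by omega)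
    have hd := measureReal_sdiff (μ := P) hsub (hX.measurable (hAm m))
    rw [hconst m, sub_self] at hd
    refine le_antisymm ((measureReal_mono ?_).trans hd.le) measureReal_nonneg
    rintro ω ⟨h1, h2⟩
    refine ⟨h1, fun h3 => h3 m le_rfl ?_⟩
    rwa [zero_add] at h2
  have hlim := hX.tendsto_past hQ hD (hAm 0) (hAp 0) e
  simp only [hzero] at hlim
  have h0 := tendsto_nhds_unique tendsto_const_nhds hlim
  have hA0 : P.real (X ⁻¹' A 0) = 0 := (mul_eq_zero.1 h0.symm).resolve_right he.ne'
  refine ae_all_iff.2 fun n => ?_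
  have hAn := hconst n
  rw [hA0, measureReal_eq_zero_iff] at hAn
  filter_upwards [measure_eq_zero_iff_ae_notMem.1 hAn] with ω hω
  simpa [hA] using hω

theorem measureReal_zero_pos (hp0 : 0 < p) (hp1 : p < 1)
    (hh : IsPerronPair (restrictedWalk p K) lam h)
    (hX : IsStationaryMarkovChain P W (doobTransform (restrictedWalk p K) lam h)) :
    0 < P.real {ω | W ω 0 = 0} := by
  have hQ := doobTransform_mem_rowStochastic hp0 hp1 hh
  have hQ0 := (Matrix.mem_rowStochastic_iff_sum.1 hQ).1
  have h1 := congrFun (hX.past_vecMul_pow hQ0 (n := 0) (B := Set.univ) MeasurableSet.univ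
    (fun _ _ _ _ => trivial) (K + 1)) 0
  simp only [Set.mem_univ, true_and, hX.coord] at h1
  rw [h1]
  have hs := sum_measureReal_coord (P := P) hX.measurable 0 Set.univ
  simp only [Set.mem_univ, true_and, probReal_univ] at hs
  obtain ⟨x, -, hx⟩ : ∃ x ∈ Finset.univ, 0 < P.real {ω | W ω 0 = x} := by
    by_contra! hc
    have := Finset.sum_nonpos hc
    linarith
  refine Finset.sum_pos' (fun y _ => mul_nonneg measureReal_nonneg
    ((Matrix.mem_rowStochastic_iff_sum.1 (pow_mem hQ (K + 1))).1 y 0)) ⟨x, Finset.mem_univ _, ?_⟩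
  exact mul_pos hx (doobTransform_pow_pos hp0 hp1 hh (K + 1) x (by omega))

/-- The chain obeys the carrier recursion of the configuration it generates, and it visits 0
arbitrarily far in the past, so no other solution is possible. -/
theorem ae_carrier_eq (hp0 : 0 < p) (hp1 : p < 1)
    (hh : IsPerronPair (restrictedWalk p K) lam h)
    (hX : IsStationaryMarkovChain P W (doobTransform (restrictedWalk p K) lam h)) :
    ∀ᵐ ω ∂P, BBSDefined (ofTransitions (upStep K) (W ω)) ∧
      ∀ n, carrier (ofTransitions (upStep K) (W ω)) n = ((W ω n : ℕ) : ℤ) := by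
  have hQ := doobTransform_mem_rowStochastic hp0 hp1 hh
  filter_upwards [hX.ae_transition, hX.ae_exists_visit hQ (isDoeblin_doobTransform hp0 hp1 hh)
    (measureReal_zero_pos hp0 hp1 hh hX)] with ω h1 h2
  refine carrier_eq_of_recursion (V := fun n => ((W ω n : ℕ) : ℤ)) (fun n => by positivity) ?_ ?_
  · intro n
    have h3 := h1 (n - 1)
    rw [sub_add_cancel] at h3
    have h4 : restrictedWalk p K (W ω (n - 1)) (W ω n) ≠ 0 := by
      intro h0
      apply h3
      simp [doobTransform, h0]
    simp only [restrictedWalk] at h4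
    simp only [ofTransitions, upStep]
    split_ifs at h4 ⊢ with c1 c2
    · simp only [Fin.val_one, Nat.cast_one]
      omega
    · simp only [Fin.val_zero, Nat.cast_zero]
      omega
    · exact absurd rfl h4
  · intro n
    obtain ⟨m, hm, h3⟩ := h2 n
    exact ⟨m, hm, by simp [h3]⟩

/-- The chain moves by at most one, so stationarity balances the crossings of each level, which is
detailed balance. -/
theorem map_bounded_carrier_reverse
    (hX : IsStationaryMarkovChain P W (doobTransform (restrictedWalk p K) lam h)) (c : ℤ) :
    P.map (fun ω n => W ω (c - n)) = P.map W := by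
  set Q := doobTransform (restrictedWalk p K) lam h with hQdef
  have hvan : ∀ x y : Fin (K + 1), restrictedWalk p K x y = 0 → Q x y = 0 := by
    intro x y hxy
    simp [hQdef, doobTransform, hxy]
  have hup : ∀ x y : Fin (K + 1), (y : ℕ) = x + 1 →
      P.real {ω | W ω 0 = x} * Q x y = P.real {ω | W ω 0 = y} * Q y x := by
    intro x y hxy
    have hm : ∀ n, Measurable fun ω => ((W ω n : ℕ) : ℤ) := fun n =>
      (measurable_from_top (f := fun a : Fin (K + 1) => ((a : ℕ) : ℤ))).comp
        ((measurable_pi_apply n).comp hX.measurable)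
    have h := measureReal_up_eq_down (P := P) (hm 0) (hm (0 + 1)) ?_ ?_ ((x : ℕ) : ℤ)
    · rw [← hX.pair 0 x y, ← hX.pair 0 y x]
      convert h using 3
      · ext ω
        simp only [Fin.ext_iff]
        omega
      · ext ω
        simp only [Fin.ext_iff]
        omega
    · filter_upwards [hX.ae_transition] with ω hω
      have h4 := mt (hvan _ _) (hω 0)
      simp only [restrictedWalk] at h4
      rw [abs_le]
      split_ifs at h4
      · omega
      · omega
      · exact absurd rfl h4
    · intro w
      have hS : MeasurableSet {f : ℤ → Fin (K + 1) | ((f 0 : ℕ) : ℤ) ≤ w} :=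
        ((measurable_pi_apply (0 : ℤ) : Measurable fun f : ℤ → Fin (K + 1) => f 0)
          (Set.toFinite {a : Fin (K + 1) | ((a : ℕ) : ℤ) ≤ w}).measurableSet)
      exact (measure_shift_eq hX.measurable hX.stationary 1 hS).symm
  refine map_reverse_eq (ν := fun x => P.real {ω | W ω 0 = x}) (R := Q) hX.measurable
    (fun n e => hX.coord n e) hX.markov (fun x => x) (fun x => rfl) (fun x => rfl) ?_ c
  intro x y
  rcases lt_trichotomy (x : ℕ) (y : ℕ) with hxy | hxy | hxy
  · by_cases h1 : (y : ℕ) = x + 1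
    · exact hup x y h1
    · rw [hvan x y, hvan y x, mul_zero, mul_zero]
      · simp only [restrictedWalk]
        rw [if_neg (by omega), if_neg (by omega)]
      · simp only [restrictedWalk]
        rw [if_neg (by omega), if_neg (by omega)]
  · rw [Fin.ext hxy]
  · by_cases h1 : (x : ℕ) = y + 1
    · exact (hup y x h1).symm
    · rw [hvan x y, hvan y x, mul_zero, mul_zero]
      · simp only [restrictedWalk]
        rw [if_neg (by omega), if_neg (by omega)]
      · simp only [restrictedWalk]
        rw [if_neg (by omega), if_neg (by omega)]

end BoundedCarrier

/-! ### The bounded example: reversible configuration, density, conclusion -/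

section BoundedSoliton

variable {Ω : Type*} [MeasurableSpace Ω] {P : Measure Ω} [IsProbabilityMeasure P]
  {K : ℕ} {p lam : ℝ} {h : Fin (K + 1) → ℝ} {W : Ω → ℤ → Fin (K + 1)}

/-- The factors `h` of the Doob transform telescope along the path, leaving `1 / h` at its start,
`h` at its end and a power of `lam`. -/
theorem measureReal_particles_and_carrier (hp0 : 0 < p) (hp1 : p < 1)
    (hh : IsPerronPair (restrictedWalk p K) lam h)
    (hX : IsStationaryMarkovChain P W (doobTransform (restrictedWalk p K) lam h))
    (n : ℤ) (k : ℕ) (e : ℕ → Fin 2) (y : Fin (K + 1)) :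
    P.real {ω | (∀ i < k, ofTransitions (upStep K) (W ω) (n + 1 + i) = e i) ∧ W ω (n + k) = y} =
      (lam ^ k)⁻¹ * Matrix.vecMul (fun x => P.real {ω | W ω 0 = x} / h x)
        (((List.range k).map e).map (walkPart p K)).prod y * h y := by
  have hlam := hh.lam_pos hp0 hp1
  have hQ0 := doobTransform_nonneg hp0 hp1 hh
  induction k generalizing y with
  | zero =>
    have := (hh.1 y).ne'
    simp only [Nat.not_lt_zero, false_imp_iff, implies_true, true_and, Nat.cast_zero, add_zero,
      hX.coord, List.range_zero, List.map_nil, List.prod_nil, Matrix.vecMul_one, pow_zero, inv_one,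
      one_mul]
    field_simp
  | succ k ih =>
    set B : Set (ℤ → Fin (K + 1)) :=
      {x | ∀ i < k, ofTransitions (upStep K) x (n + 1 + i) = e i} with hB
    have hBm : MeasurableSet B := by
      have : B = ⋂ i : ℕ, ⋂ _ : i < k,
          ofTransitions (upStep K) ⁻¹' {η | η (n + 1 + (i : ℤ)) = e i} := by
        ext x
        simp [hB]
      rw [this]
      exact MeasurableSet.iInter fun i => MeasurableSet.iInter fun _ =>
        measurable_ofTransitions (upStep K) (measurableSet_coord _ _)
    have hBp : IsPast (n + k) B := by
      intro f g hfg hf i hi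
      rw [← hf i hi]
      simp only [ofTransitions]
      rw [hfg _ (by omega), hfg _ (by omega)]
    have e1 : n + ((k + 1 : ℕ) : ℤ) = n + k + 1 := by push_cast; ring
    rw [← sum_measureReal_coord (P := P) hX.measurable (n + k), List.range_succ, List.map_append,
      List.map_append, List.prod_append, ← Matrix.vecMul_vecMul]
    simp only [List.map_cons, List.map_nil, List.prod_cons, List.prod_nil, mul_one]
    conv_rhs => rw [Matrix.vecMul, dotProduct, Finset.mul_sum, Finset.sum_mul]
    refine Finset.sum_congr rfl fun x _ => ?_
    have e2 : {ω | ω ∈ {ω | (∀ i < k + 1, ofTransitions (upStep K) (W ω) (n + 1 + i) = e i) ∧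
        W ω (n + (k + 1 : ℕ)) = y} ∧ W ω (n + k) = x} =
        {ω | upStep K x y = e k ∧ W ω ∈ B ∧ W ω (n + k) = x ∧ W ω (n + k + 1) = y} := by
      ext ω
      have e3 : ofTransitions (upStep K) (W ω) (n + 1 + k) =
          upStep K (W ω (n + k)) (W ω (n + k + 1)) := by
        simp only [ofTransitions]
        congr 2 <;> ring
      simp only [Set.mem_ofPred_eq, e1, hB]
      constructor
      · rintro ⟨⟨h1, h2⟩, h3⟩
        refine ⟨?_, fun i hi => h1 i (by omega), h3, h2⟩
        rw [← h1 k (by omega), e3, h2, h3]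
      · rintro ⟨h1, h2, h3, h4⟩
        refine ⟨⟨fun i hi => ?_, h4⟩, h3⟩
        rcases Nat.lt_succ_iff_lt_or_eq.1 hi with hi | rfl
        · exact h2 i hi
        · rw [e3, h3, h4, h1]
    rw [e2]
    simp only [walkPart]
    split_ifs with hxy
    · simp only [hxy, true_and]
      rw [hX.past hQ0 hBm hBp x y]
      have := ih x
      simp only [hB, Set.mem_ofPred_eq]
      rw [this, doobTransform, pow_succ]
      have hx := (hh.1 x).ne'
      field_simp
    · simp [hxy]

/-- The stationary law divided by `h` is a left eigenvector of the restricted walk; duality turns it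
into a right eigenvector for the same `lam`, which is proportional to `h` by uniqueness. -/
theorem exists_smul_dualityMatrix_mulVec (hp0 : 0 < p) (hp1 : p < 1)
    (hh : IsPerronPair (restrictedWalk p K) lam h)
    (hX : IsStationaryMarkovChain P W (doobTransform (restrictedWalk p K) lam h)) :
    ∃ c : ℝ, h = c • (dualityMatrix K).mulVec (fun x => P.real {ω | W ω 0 = x} / h x) := by
  have hlam := hh.lam_pos hp0 hp1
  set g : Fin (K + 1) → ℝ := fun x => P.real {ω | W ω 0 = x} / h x with hg
  set u := (dualityMatrix K).mulVec g with hu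
  have hgA : Matrix.vecMul g (restrictedWalk p K) = lam • g := by
    funext y
    have h1 := congrFun (hX.past_vecMul (doobTransform_nonneg hp0 hp1 hh) (n := 0)
      (B := Set.univ) MeasurableSet.univ (fun _ _ _ _ => trivial)) y
    simp only [Set.mem_univ, true_and, hX.coord, Matrix.vecMul, dotProduct] at h1
    simp only [Matrix.vecMul, dotProduct, Pi.smul_apply, smul_eq_mul, hg]
    rw [h1, Finset.sum_div, Finset.mul_sum]
    refine Finset.sum_congr rfl fun x _ => ?_
    have hx := (hh.1 x).ne'
    have hy := (hh.1 y).ne'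
    simp only [doobTransform]
    field_simp
  have hdual : restrictedWalk p K * dualityMatrix K =
      dualityMatrix K * (restrictedWalk p K).transpose := by
    rw [← walkPart_add, Matrix.add_mul, Matrix.transpose_add, Matrix.mul_add,
      walkPart_mul_dualityMatrix, walkPart_mul_dualityMatrix]
  have hAu : (restrictedWalk p K).mulVec u = lam • u := by
    rw [hu, Matrix.mulVec_mulVec, hdual, ← Matrix.mulVec_mulVec, Matrix.mulVec_transpose, hgA,
      Matrix.mulVec_smul]
  have hg0 : ∀ x, 0 ≤ g x := fun x => div_nonneg measureReal_nonneg (hh.1 x).le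
  have hu0 : 0 < u 0 := by
    have h1 : g 0 ≤ u 0 := by
      have e : dualityMatrix K 0 0 = 1 := by simp [dualityMatrix]
      rw [← one_mul (g 0), ← e]
      refine Finset.single_le_sum (f := fun y => dualityMatrix K 0 y * g y) (fun y _ => ?_)
        (Finset.mem_univ 0)
      refine mul_nonneg ?_ (hg0 y)
      simp only [dualityMatrix]
      split_ifs <;> norm_num
    exact (div_pos (measureReal_zero_pos hp0 hp1 hh hX) (hh.1 0)).trans_le h1
  have hw := eq_zero_of_restrictedWalk_mulVec (w := h - (h 0 / u 0) • u) hp0 (lam := lam) ?_ ?_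
  · exact ⟨h 0 / u 0, sub_eq_zero.1 hw⟩
  · rw [Matrix.mulVec_sub, Matrix.mulVec_smul, hAu, hh.2, smul_sub, smul_comm]
  · simp [hu0.ne']

/-- Summing over the final state leaves `h` at the end; writing it through `dualityMatrix` puts the
same vector at both ends of the word, the form to which the symmetry under word reversal applies. -/
theorem measureReal_particles (hp0 : 0 < p) (hp1 : p < 1)
    (hh : IsPerronPair (restrictedWalk p K) lam h)
    (hX : IsStationaryMarkovChain P W (doobTransform (restrictedWalk p K) lam h)) {c : ℝ}
    (hc : h = c • (dualityMatrix K).mulVec (fun x => P.real {ω | W ω 0 = x} / h x))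
    (n : ℤ) (k : ℕ) (e : ℕ → Fin 2) :
    P.real {ω | ∀ i < k, ofTransitions (upStep K) (W ω) (n + 1 + i) = e i} =
      (lam ^ k)⁻¹ * c * (Matrix.vecMul (fun x => P.real {ω | W ω 0 = x} / h x)
        (((List.range k).map e).map (walkPart p K)).prod ⬝ᵥ
          (dualityMatrix K).mulVec (fun x => P.real {ω | W ω 0 = x} / h x)) := by
  rw [← sum_measureReal_coord (P := P) hX.measurable (n + k), mul_assoc, ← smul_eq_mul c,
    ← dotProduct_smul, ← hc, dotProduct, Finset.mul_sum]
  refine Finset.sum_congr rfl fun y _ => ?_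
  rw [← mul_assoc]
  exact measureReal_particles_and_carrier hp0 hp1 hh hX n k e y

theorem map_bounded_config_reverse (hp0 : 0 < p) (hp1 : p < 1)
    (hh : IsPerronPair (restrictedWalk p K) lam h)
    (hX : IsStationaryMarkovChain P W (doobTransform (restrictedWalk p K) lam h)) :
    (P.map fun ω => ofTransitions (upStep K) (W ω)).map (fun η n => η (1 - n)) =
      P.map fun ω => ofTransitions (upStep K) (W ω) := by
  have hf : Measurable fun ω => ofTransitions (upStep K) (W ω) :=
    (measurable_ofTransitions _).comp hX.measurable
  have hr : Measurable fun (η : Config) (n : ℤ) => η (1 - n) := by fun_prop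
  have : IsProbabilityMeasure (P.map fun ω => ofTransitions (upStep K) (W ω)) :=
    Measure.isProbabilityMeasure_map hf.aemeasurable
  obtain ⟨c, hc⟩ := exists_smul_dualityMatrix_mulVec hp0 hp1 hh hX
  refine ext_of_int_windows fun n k x => ?_
  have hw := measurableSet_window n k x
  rw [← measureReal_eq_measureReal_iff, map_measureReal_apply hr hw,
    map_measureReal_apply hf (hr hw), map_measureReal_apply hf hw]
  have e1 : (fun ω => ofTransitions (upStep K) (W ω)) ⁻¹'
      ((fun (η : Config) (n : ℤ) => η (1 - n)) ⁻¹'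
      {f | ∀ i ≤ k, f (n + (i : ℤ)) = x i}) =
      {ω | ∀ i < k + 1, ofTransitions (upStep K) (W ω) (-n - k + 1 + i) =
        (fun j => x (k - j)) i} := by
    ext ω
    simp only [Set.mem_preimage, Set.mem_ofPred_eq]
    constructor
    · intro h i hi
      rw [← h (k - i) (by omega)]
      congr 1
      omega
    · intro h i hi
      have := h (k - i) (by omega)
      rw [show k - (k - i) = i by omega] at this
      rw [← this]
      congr 1
      omega
  have e2 : (fun ω => ofTransitions (upStep K) (W ω)) ⁻¹' {f | ∀ i ≤ k, f (n + (i : ℤ)) = x i} =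
      {ω | ∀ i < k + 1, ofTransitions (upStep K) (W ω) (n - 1 + 1 + i) = x i} := by
    ext ω
    simp only [Set.mem_preimage, Set.mem_ofPred_eq, sub_add_cancel, Nat.lt_succ_iff]
  rw [e1, e2, measureReal_particles hp0 hp1 hh hX hc, measureReal_particles hp0 hp1 hh hX hc,
    dotProduct_prod_walkPart_reverse]
  have e3 : ((List.range (k + 1)).map fun j => x (k - j)).reverse = (List.range (k + 1)).map x := by
    refine List.ext_getElem (by simp) fun i h1 h2 => ?_
    simp only [List.length_map, List.length_range] at h2
    simp only [List.getElem_reverse, List.getElem_map, List.getElem_range, List.length_map,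
      List.length_range]
    congr 1
    omega
  rw [e3]

/-- Up-steps and down-steps are equally likely by reversal, and the step 0 → 0 takes a positive
share of the total mass. -/
theorem measureReal_bounded_particle_lt (hp0 : 0 < p) (hp1 : p < 1)
    (hh : IsPerronPair (restrictedWalk p K) lam h)
    (hX : IsStationaryMarkovChain P W (doobTransform (restrictedWalk p K) lam h)) :
    (P.map fun ω => ofTransitions (upStep K) (W ω)).real {η | η 0 = 1} < 1 / 2 := by
  have hf : Measurable fun ω => ofTransitions (upStep K) (W ω) :=
    (measurable_ofTransitions _).comp hX.measurable
  have hfin : ∀ s : Fin (K + 1) → Fin (K + 1) → Prop,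
      MeasurableSet {f : ℤ → Fin (K + 1) | s (f (-1)) (f 0)} := by
    intro s
    have hm : Measurable fun f : ℤ → Fin (K + 1) => (f (-1), f 0) := by fun_prop
    exact hm (Set.toFinite {a : Fin (K + 1) × Fin (K + 1) | s a.1 a.2}).measurableSet
  have hup := hfin fun x y => (y : ℕ) = x + 1
  have hdown := hfin fun x y => (x : ℕ) = y + 1
  have hflat := hfin fun x y => x = 0 ∧ y = 0
  have hrev := congrArg (fun ν => ν.real {f | (f 0 : ℕ) = f (-1) + 1})
    (map_bounded_carrier_reverse hX (-1))
  have hr : Measurable fun ω n => W ω (-1 - n) := by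
    have := hX.measurable
    fun_prop
  rw [map_measureReal_apply hr hup, map_measureReal_apply hX.measurable hup] at hrev
  have hpos : 0 < P.real (W ⁻¹' {f | f (-1) = 0 ∧ f 0 = 0}) := by
    have h1 := hX.pair (-1) 0 0
    have h2 : 0 < doobTransform (restrictedWalk p K) lam h 0 0 := by
      refine doobTransform_pos hp0 hp1 hh ?_
      simp [restrictedWalk, hp1]
    have h3 := mul_pos (measureReal_zero_pos hp0 hp1 hh hX) h2
    rw [← h1] at h3
    exact h3
  have e0 : (P.map fun ω => ofTransitions (upStep K) (W ω)).real {η | η 0 = 1} =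
      P.real (W ⁻¹' {f | (f 0 : ℕ) = f (-1) + 1}) := by
    rw [map_measureReal_apply hf (measurableSet_coord 0 1)]
    congr 1
    ext ω
    simp [ofTransitions, upStep]
  have e1 : (fun ω n => W ω (-1 - n)) ⁻¹' {f | (f 0 : ℕ) = f (-1) + 1} =
      W ⁻¹' {f | (f (-1) : ℕ) = f 0 + 1} := by
    ext ω
    simp
  rw [e1] at hrev
  have hd1 : Disjoint (W ⁻¹' {f | (f 0 : ℕ) = f (-1) + 1}) (W ⁻¹' {f | (f (-1) : ℕ) = f 0 + 1}) := by
    refine Set.disjoint_left.2 fun ω h1 h2 => ?_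
    simp only [Set.mem_preimage, Set.mem_ofPred_eq] at h1 h2
    omega
  have hd2 : Disjoint (W ⁻¹' {f | (f 0 : ℕ) = f (-1) + 1} ∪ W ⁻¹' {f | (f (-1) : ℕ) = f 0 + 1})
      (W ⁻¹' {f | f (-1) = 0 ∧ f 0 = 0}) := by
    refine Set.disjoint_left.2 ?_
    rintro ω (h1 | h1) ⟨h2, h3⟩ <;>
      simp [h2, h3] at h1
  have hu1 := measureReal_union (μ := P) hd1 (hX.measurable hdown)
  have hu2 := measureReal_union (μ := P) hd2 (hX.measurable hflat)
  have hle : P.real ((W ⁻¹' {f | (f 0 : ℕ) = f (-1) + 1} ∪ W ⁻¹' {f | (f (-1) : ℕ) = f 0 + 1}) ∪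
      W ⁻¹' {f | f (-1) = 0 ∧ f 0 = 0}) ≤ 1 := measureReal_le_one
  rw [e0]
  linarith

theorem ergodic_bbs_of_bounded_carrier (hp0 : 0 < p) (hp1 : p < 1)
    (hh : IsPerronPair (restrictedWalk p K) lam h)
    (hX : IsStationaryMarkovChain P W (doobTransform (restrictedWalk p K) lam h)) :
    (∀ᵐ ω ∂P, BBSDefined (ofTransitions (upStep K) (W ω))) ∧
      Ergodic bbs (P.map fun ω => ofTransitions (upStep K) (W ω)) := by
  have hf : Measurable fun ω => ofTransitions (upStep K) (W ω) :=
    (measurable_ofTransitions _).comp hX.measurable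
  have hcar := ae_carrier_eq hp0 hp1 hh hX
  have hdef : ∀ᵐ η ∂(P.map fun ω => ofTransitions (upStep K) (W ω)), BBSDefined η :=
    (ae_map_iff hf.aemeasurable measurableSet_bbsDefined).2 (hcar.mono fun ω h => h.1)
  have hc : Measurable carrier := measurable_pi_iff.2 measurable_carrier
  have hc' : Measurable fun (η : Config) (n : ℤ) => carrier η (-n) :=
    measurable_pi_iff.2 fun n => measurable_carrier (-n)
  have hcast : Measurable fun (f : ℤ → Fin (K + 1)) (n : ℤ) => ((f n : ℕ) : ℤ) :=
    measurable_pi_iff.2 fun n => (measurable_from_top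
      (f := fun a : Fin (K + 1) => ((a : ℕ) : ℤ))).comp (measurable_pi_apply n)
  have hneg : Measurable fun ω n => W ω (0 - n) := by
    have := hX.measurable
    fun_prop
  have hW : (P.map fun ω => ofTransitions (upStep K) (W ω)).map (fun η n => carrier η (-n)) =
      (P.map fun ω => ofTransitions (upStep K) (W ω)).map carrier := by
    have h1 := congrArg (fun ν => ν.map fun (f : ℤ → Fin (K + 1)) (n : ℤ) => ((f n : ℕ) : ℤ))
      (map_bounded_carrier_reverse hX 0)
    rw [Measure.map_map hcast hneg, Measure.map_map hcast hX.measurable] at h1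
    rw [Measure.map_map hc' hf, Measure.map_map hc hf]
    refine (Measure.map_congr (hcar.mono fun ω h => ?_)).trans
      (h1.trans (Measure.map_congr (hcar.mono fun ω h => ?_)))
    · funext n
      simp only [Function.comp]
      rw [h.2, zero_sub]
    · funext n
      exact (h.2 n).symm
  exact ⟨hcar.mono fun ω h => h.1, hX.ergodic_bbs (doobTransform_mem_rowStochastic hp0 hp1 hh)
    (isDoeblin_doobTransform hp0 hp1 hh) _ hdef
    (measurePreserving_bbs hdef (map_bounded_config_reverse hp0 hp1 hh hX) hW)
    (measureReal_bounded_particle_lt hp0 hp1 hh hX)⟩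

end BoundedSoliton

theorem corollary1p8 {Ω : Type*} [MeasurableSpace Ω] (P : Measure Ω) [IsProbabilityMeasure P]
    (η : Ω → Config) (hη : Measurable η)
    (hex : IsIIDExample P η ∨ IsMarkovExample P η ∨ IsBoundedSolitonExample P η) :
    (∀ᵐ ω ∂P, BBSDefined (η ω)) ∧ Ergodic bbs (P.map η) := by
  rcases hex with ⟨p, hp0, hp1, hind, hp⟩ | ⟨p₀, p₁, h0, h0', h1, h1', hp, hX⟩ |
    ⟨K, p, lam, h, W, hp0, hp1, hh, hX, hW⟩
  · exact ergodic_bbs_of_two_states hp0 (by linarith) hp0 (by linarith) (by linarith)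
      (isStationaryMarkovChain_of_iid hη hind hp)
  · exact ergodic_bbs_of_two_states h0.le h0' h1 h1' hp hX
  · have hae : η =ᵐ[P] fun ω => ofTransitions (upStep K) (W ω) :=
      hW.mono fun ω h => funext fun n => h n
    obtain ⟨h1, h2⟩ := ergodic_bbs_of_bounded_carrier hp0 hp1 hh hX
    rw [Measure.map_congr hae]
    refine ⟨?_, h2⟩
    filter_upwards [h1, hae] with ω ha hb
    rwa [hb]
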